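/- Let $T:X\to X$ be a measurable transformation with an induced map $F=T^{\varphi}:Y\to Y$, $Y\subset X$, where $\varphi:Y\to\{1,2,\dots\}$ is measurable (not necessarily the first return time), and let $\mu$ be an ergodic $F$-invariant probability measure on $Y$ with $\varphi\in L^1(Y,\mu)$. Put $\Delta=\{(y,l)\in Y\times\mathbb Z: 0\le l<\varphi(y)\}$, $\mu_\Delta=(\mu\times\text{counting})|_\Delta/\int\varphi\,d\mu$, $\pi(y,l)=T^l y$, $\mu_X=\pi_*\mu_\Delta$, and for $v,w:X\to\mathbb R$ $$\rho_{v,w}(n)=\int_X v\;w\circ T^n\,d\mu_X-\int_X v\,d\mu_X\int_X w\,d\mu_X .$$ Let $R:L^1(Y)\to L^1(Y)$ be the transfer operator of $F$ (so $\int_Y Ru\;w\,d\mu=\int_Y u\;w\circ F\,d\mu$ for $w\in L^\infty(Y)$) and $R_n u=R(1_{\{\varphi=n\}}u)$. Let $\mathcal B(Y)\subset L^1(Y)$ be a (complex) Banach space with norm $\|\cdot\|$, $|u|_1\le\|u\|$, which contains the constants and is continuously embedded in $L^\infty(Y)$. Assume that the inducing scheme is excellent with respect to $\mathcal B(Y)$: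 * (H1) each $R_n$ restricts to a bounded operator on $\mathcal B(Y)$, and there is a constant $C$ with $\|R_n\|\le C\mu(\varphi\ge n)$ for all $n\ge1$ (in particular this holds if $\|R_n\|\ll\mu(\varphi>n)$ or if $\|R_n\|\ll\mu(\varphi=n)$); * (H2) with $R(z)=\sum_{n\ge1}R_nz^n$, the eigenvalue $1$ of $R(1)$ is (algebraically) simple and isolated in the spectrum of $R(1)$, and $1$ is not in the spectrum of $R(z)$ for $|z|\le1$, $z\ne1$. For $v:X\to\mathbb R$ let $\mathcal D_v$ be the set of $\hat v:Y\to\mathbb R$ such that for every $n\ge1$ there is $j\in\{0,\dots,n-1\}$ with $\hat v(y)=v(T^jy)$ for all $y$ with $\varphi(y)=n$. Call $v\in L^1(X,\mu_X)$ exchangeable if $\mathcal D_v$ is a bounded subset of $\mathcal B(Y)$, and put $\|v\|=\sup_{\hat v\in\mathcal D_v}\|\hat v\|$. Let $\ell:(0,\infty)\to(0,\infty)$ be slowly varying, i.e. $\lim_{x\to\infty}\ell(\lambda x)/\ell(x)=1$ for every $\lambda>0$, let the sequence $\ell(n)$, $n\ge1$, be decreasing (not necessarily strictly) with $\ell(n)\to0$,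 and suppose that $\mu(\varphi>n)\le C'\,\ell(n)/n$ for some constant $C'$ and all $n\ge1$. Then there is a constant $C>0$ such that, for all exchangeable $v$, all $w\in L^\infty(X,\mu_X)$ and all $n\ge1$, $$|\rho_{v,w}(n)|\le C\,\|v\|\,|w|_\infty\sum_{j\ge n}\frac{\ell(j)}{j}$$ (the sum being allowed to be $+\infty$, with $0\cdot\infty=0$). -/

import Mathlib

open MeasureTheory Filter Topology
open scoped ENNReal

section TransferOperator

variable {α : Type*} [MeasurableSpace α]

/-- `g = R u`, where `R` is the transfer operator on `L¹(μ)` of the map `F`: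
`∫ g w dμ = ∫ u (w ∘ F) dμ` for every bounded measurable `w`. -/
def IsTransfer (μ : Measure α) (F : α → α) (u g : Lp ℂ 1 μ) : Prop :=
  ∀ w : α → ℂ, Measurable w → (∃ K : ℝ, ∀ y, ‖w y‖ ≤ K) →
    ∫ y, g y * w y ∂μ = ∫ y, u y * w (F y) ∂μ

theorem exists_isTransfer {μ : Measure α} [IsProbabilityMeasure μ] {F : α → α}
    (hF : MeasurePreserving F μ μ) (u : Lp ℂ 1 μ) : ∃ g, IsTransfer μ F u g := by
  have hm := hF.measurable.comap_le
  have hu : Integrable u μ := L1.integrable_coeFn u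
  obtain ⟨h, hh, hc⟩ := (stronglyMeasurable_condExp (f := (u : α → ℂ)) (μ := μ)
    (m := MeasurableSpace.comap F inferInstance)).exists_eq_measurable_comp
  have hint : Integrable h μ := by
    have h1 : Integrable (h ∘ F) μ := hc ▸ integrable_condExp
    exact (hF.integrable_comp hh.aestronglyMeasurable).1 h1
  refine ⟨hint.toL1 h, fun w hw ⟨K, hK⟩ => ?_⟩
  have hwF : StronglyMeasurable[MeasurableSpace.comap F inferInstance] (fun y => w (F y)) :=
    (hw.comp (comap_measurable F)).stronglyMeasurable
  have huw : Integrable (fun y => u y * w (F y)) μ :=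
    hu.mul_bdd (c := K) (hw.comp hF.measurable).aestronglyMeasurable
      (ae_of_all _ fun y => hK (F y))
  have pull := condExp_bilin_of_stronglyMeasurable_right (μ := μ)
    (ContinuousLinearMap.mul ℝ ℂ) hwF (f := u) huw hu
  calc ∫ y, hint.toL1 h y * w y ∂μ = ∫ y, h y * w y ∂μ := by
        refine integral_congr_ae ?_
        filter_upwards [hint.coeFn_toL1] with y hy using by rw [hy]
    _ = ∫ y, h (F y) * w (F y) ∂μ := by
        conv_lhs => rw [← hF.map_eq]
        exact integral_map hF.measurable.aemeasurable
          (hh.aestronglyMeasurable.mul hw.aestronglyMeasurable)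
    _ = ∫ y, (μ[fun y => u y * w (F y) | MeasurableSpace.comap F inferInstance]) y ∂μ := by
        refine integral_congr_ae ?_
        filter_upwards [pull] with y hy
        have : h (F y) = (μ[(u : α → ℂ) | MeasurableSpace.comap F inferInstance]) y := by
          rw [hc]; rfl
        rw [this]
        exact hy.symm
    _ = ∫ y, u y * w (F y) ∂μ := integral_condExp hm

theorem IsTransfer.unique {μ : Measure α} [IsProbabilityMeasure μ] {F : α → α}
    {u g g' : Lp ℂ 1 μ} (h : IsTransfer μ F u g) (h' : IsTransfer μ F u g') : g = g' := by
  refine Lp.ext (Integrable.ae_eq_of_forall_setIntegral_eq _ _ (L1.integrable_coeFn g)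
    (L1.integrable_coeFn g') fun s hs _ => ?_)
  have key : ∀ k : Lp ℂ 1 μ, ∫ y in s, k y ∂μ = ∫ y, k y * s.indicator (fun _ => (1 : ℂ)) y ∂μ := by
    intro k
    rw [← integral_indicator hs]
    congr 1
    ext y
    by_cases hy : y ∈ s <;> simp [hy]
  have hb : ∃ K : ℝ, ∀ y, ‖s.indicator (fun _ => (1 : ℂ)) y‖ ≤ K :=
    ⟨1, fun y => by by_cases hy : y ∈ s <;> simp [hy]⟩
  have hmeas : Measurable (s.indicator (fun _ => (1 : ℂ))) := measurable_const.indicator hs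
  rw [key, key, h _ hmeas hb, h' _ hmeas hb]

/-- The transfer operator `R : L¹(μ) → L¹(μ)` of a measure preserving map `F`. -/
noncomputable def transferOp (μ : Measure α) [IsProbabilityMeasure μ] (F : α → α)
    (hF : MeasurePreserving F μ μ) (u : Lp ℂ 1 μ) : Lp ℂ 1 μ :=
  (exists_isTransfer hF u).choose

theorem isTransfer_transferOp (μ : Measure α) [IsProbabilityMeasure μ] (F : α → α)
    (hF : MeasurePreserving F μ μ) (u : Lp ℂ 1 μ) :
    IsTransfer μ F u (transferOp μ F hF u) :=
  (exists_isTransfer hF u).choose_spec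

/-- Multiplication by the indicator function `1_s` on `L¹(μ)`. -/
noncomputable def mulIndicatorL1 (μ : Measure α) {s : Set α} (hs : MeasurableSet s)
    (u : Lp ℂ 1 μ) : Lp ℂ 1 μ :=
  ((Lp.memLp u).indicator hs).toLp (s.indicator u)

end TransferOperator

/-- A transformation `T : X → X` together with an induced map `F = T^φ : Y → Y` on a subset `Y`,
with an `F`-invariant ergodic probability measure `μ` on `Y` such that the return time
`φ : Y → {1, 2, …}` is `μ`-integrable (`φ` need not be the first return time). -/
structure InducingScheme (X : Type*) [MeasurableSpace X] where
  T : X → X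
  measurable_T : Measurable T
  Y : Set X
  φ : Y → ℕ
  measurable_φ : Measurable φ
  φ_pos : ∀ y, 1 ≤ φ y
  mapsTo : ∀ y : Y, T^[φ y] (y : X) ∈ Y
  μ : Measure Y
  isProb : IsProbabilityMeasure μ
  ergodic : Ergodic (fun y : Y => (⟨T^[φ y] (y : X), mapsTo y⟩ : Y)) μ
  integrable_φ : Integrable (fun y => (φ y : ℝ)) μ

namespace InducingScheme

variable {X : Type*} [MeasurableSpace X] (S : InducingScheme X)

instance : IsProbabilityMeasure S.μ := S.isProb

/-- The induced map `F = T^φ : Y → Y`. -/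
def F (y : S.Y) : S.Y := ⟨S.T^[S.φ y] (y : X), S.mapsTo y⟩

theorem measurePreserving_F : MeasurePreserving S.F S.μ S.μ := S.ergodic.toMeasurePreserving

theorem measurableSet_level (n : ℕ) : MeasurableSet {y | S.φ y = n} :=
  S.measurable_φ (measurableSet_singleton n)

/-- The operator `R_n = R 1_{φ = n}` on `L¹(Y)`. -/
noncomputable def renewalOp (n : ℕ) (u : Lp ℂ 1 S.μ) : Lp ℂ 1 S.μ :=
  transferOp S.μ S.F S.measurePreserving_F (mulIndicatorL1 S.μ (S.measurableSet_level n) u)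

/-- The tower `Δ = {(y, l) : 0 ≤ l < φ y}`. -/
def tower : Set (S.Y × ℕ) := {p | p.2 < S.φ p.1}

/-- The probability measure `(μ × counting) / ∫ φ dμ` on the tower. -/
noncomputable def towerMeasure : Measure (S.Y × ℕ) :=
  (∫⁻ y, (S.φ y : ℝ≥0∞) ∂S.μ)⁻¹ • (S.μ.prod Measure.count).restrict S.tower

/-- The measure `μ_X = π_* μ_Δ` on `X`, where `π (y, l) = T^l y`. -/
noncomputable def μX : Measure X :=
  S.towerMeasure.map (fun p => S.T^[p.2] (p.1 : X))

/-- The correlation function `ρ_{v,w}(n)`. -/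
noncomputable def corr (v w : X → ℝ) (n : ℕ) : ℝ :=
  ∫ x, v x * w (S.T^[n] x) ∂S.μX - (∫ x, v x ∂S.μX) * ∫ x, w x ∂S.μX

/-- The set `D_v` of observables on `Y` derived from `v : X → ℝ`: on each level set `{φ = n}` they
agree with `v ∘ T^j` for some `j ∈ {0, …, n - 1}`. -/
def derived (v : X → ℝ) : Set (S.Y → ℝ) :=
  {u | ∀ n, 1 ≤ n → ∃ j < n, ∀ y, S.φ y = n → u y = v (S.T^[j] (y : X))}

end InducingScheme

/-- A complex Banach space `B` (complex because spectra of operators on it are used) of (classes of) integrable functions on a probability space: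
`B ⊆ L¹(μ)` via the injection `toL1`, with `|v|₁ ≤ ‖v‖`, containing the constants. -/
structure BanachFunctionSpace {Y : Type*} [MeasurableSpace Y] (μ : Measure Y)
    (B : Type*) [NormedAddCommGroup B] [NormedSpace ℂ B] [CompleteSpace B] where
  toL1 : B →ₗ[ℂ] Lp ℂ 1 μ
  injective : Function.Injective toL1
  norm_toL1_le : ∀ b, ‖toL1 b‖ ≤ ‖b‖
  const_mem : ∀ c : ℂ, ∃ b, toL1 b =ᵐ[μ] fun _ => c

/-- `B` is (continuously) embedded in `L^∞(μ)`. -/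
def BanachFunctionSpace.EmbeddedInLinfty {Y : Type*} [MeasurableSpace Y] {μ : Measure Y}
    {B : Type*} [NormedAddCommGroup B] [NormedSpace ℂ B] [CompleteSpace B]
    (E : BanachFunctionSpace μ B) : Prop :=
  ∃ K : ℝ, ∀ b, ∀ᵐ y ∂μ, ‖E.toL1 b y‖ ≤ K * ‖b‖

/-- `c` is a simple eigenvalue of `A` (the eigenspace is one-dimensional and the whole space is
the direct sum of the kernel and the range of `A - c`), isolated in the spectrum of `A`. -/
def IsSimpleIsolatedEigenvalue {B : Type*} [NormedAddCommGroup B] [NormedSpace ℂ B]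
    (A : B →L[ℂ] B) (c : ℂ) : Prop :=
  Module.finrank ℂ (LinearMap.ker ((A - c • ContinuousLinearMap.id ℂ B : B →L[ℂ] B) : B →ₗ[ℂ] B)) = 1 ∧
  IsCompl (LinearMap.ker ((A - c • ContinuousLinearMap.id ℂ B : B →L[ℂ] B) : B →ₗ[ℂ] B))
    (LinearMap.range ((A - c • ContinuousLinearMap.id ℂ B : B →L[ℂ] B) : B →ₗ[ℂ] B)) ∧
  ∀ᶠ z in 𝓝[≠] c, z ∉ spectrum ℂ A

namespace InducingScheme

variable {X : Type*} [MeasurableSpace X] (S : InducingScheme X)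
  {B : Type*} [NormedAddCommGroup B] [NormedSpace ℂ B] [CompleteSpace B]
  (E : BanachFunctionSpace S.μ B)

/-- The power series `R(z) = ∑ R_n z^n`; its coefficients are operators on `B`, and `R_0 = 0`
for the restrictions of the operators `R 1_{φ = n}` since `φ ≥ 1`. -/
noncomputable def powerSeries (Rn : ℕ → B →L[ℂ] B) (z : ℂ) : B →L[ℂ] B :=
  ∑' n, z ^ n • Rn n

/-- The inducing scheme is excellent with respect to the function space `B`: the operators
`R_n = R 1_{φ = n}` restrict to bounded operators on `B` with `‖R_n‖ ≪ μ(φ ≥ n)`, the eigenvalue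
`1` of `R(1)` is simple and isolated, and `1` is not in the spectrum of `R(z)` for the other
`z` in the closed unit disk. -/
def IsExcellent : Prop :=
  ∃ Rn : ℕ → B →L[ℂ] B,
    (∀ n b, E.toL1 (Rn n b) = S.renewalOp n (E.toL1 b)) ∧
    (∃ C : ℝ, ∀ n, 1 ≤ n → ‖Rn n‖ ≤ C * S.μ.real {y | n ≤ S.φ y}) ∧
    IsSimpleIsolatedEigenvalue (powerSeries Rn 1) 1 ∧
    ∀ z : ℂ, ‖z‖ ≤ 1 → z ≠ 1 → (1 : ℂ) ∉ spectrum ℂ (powerSeries Rn z)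

/-- The set of norms of the elements of `B` that represent observables derived from `v`. -/
def derivedNorms (v : X → ℝ) : Set ℝ :=
  {r | ∃ u ∈ S.derived v, ∃ b : B, (E.toL1 b =ᵐ[S.μ] fun y => (u y : ℂ)) ∧ r = ‖b‖}

/-- `v : X → ℝ` is exchangeable: `v` is integrable and `D_v` is a bounded subset of `B`. -/
def IsExchangeable (v : X → ℝ) : Prop :=
  MemLp v 1 S.μX ∧
  (∀ u ∈ S.derived v, ∃ b : B, E.toL1 b =ᵐ[S.μ] fun y => (u y : ℂ)) ∧
  BddAbove (S.derivedNorms E v)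

/-- The norm `‖v‖ = sup_{u ∈ D_v} ‖u‖` of an exchangeable observable. -/
noncomputable def exchNorm (v : X → ℝ) : ℝ := sSup (S.derivedNorms E v)

end InducingScheme

/-- `ℓ : (0,∞) → (0,∞)` is slowly varying (only the values on `(0,∞)` matter). -/
def IsSlowlyVarying (ℓ : ℝ → ℝ) : Prop :=
  (∀ x, 0 < x → 0 < ℓ x) ∧
  ∀ c : ℝ, 0 < c → Tendsto (fun x => ℓ (c * x) / ℓ x) atTop (𝓝 1)

/-! If `∑ ℓ(j)/j` diverges, the right-hand side is infinite unless `‖v‖ |w|_∞ = 0`, and in that case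
the correlation vanishes. Otherwise write `lam` for the sequence `ℓ(n)` and centre `v`, so that `∫ v
= 0`.

Cut each column of the tower according to the time left before its top. Points with more than `n`
steps left contribute at most a multiple of `∫ (φ - n)⁺ dμ = ∑_{j ≥ n} μ(φ > j)`, which is of the
claimed order. A point with `j ≤ n` steps left reaches `Y` and then has `n - j` iterates to go. Up
to that error, `(∫ φ) ∫ v (w ∘ Tⁿ)` is therefore the convolution `∑_j J_{n-j}(β_j)`, where `J_m(b) =
∫ b (w ∘ Tᵐ) dμ`, `β_j = ∑_{m ≥ j} R_m b_j`, and `b_j ∈ D_v` reads `v` at `j` steps before the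
return (`IsRenewalFamily.norm_sub_le`). Decomposing at the first return gives `J(z) (1 - R(z)) =
A(z)`, with `A_m` supported on `{φ > m}` (`IsRenewalFamily.iteratePairing_eq`), so `A (1 - R)⁻¹ β`
has to be estimated.

The singularity at `z = 1` is removed by `M(z) = ((1 - z)⁻¹ P + (1 - P)) (1 - R(z))`, where `P` is
the projection `u ↦ ∫ u` onto the constants. Since `R` preserves integrals, `M` has coefficients
built from `R_n` and from `b ↦ ∫_{φ > n} b`. Both are `O(lam n / n)`, the second because `B` embeds
in `L^∞`. The spectral hypotheses make `M(z)` invertible on the closed disk. An operator-valued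
Wiener lemma gives `N = M⁻¹` summable coefficients, and the identity `z N' = -N (z M') N` bootstraps
this to `O(lam n / n)` (`IsDoublingWeight.exists_inverse`).

Then `(1 - R)⁻¹ β = N ((1 - z)⁻¹ P β + (1 - P) β)`. The coefficients of `(1 - z)⁻¹ P β` are
integrals of partial sums of `β`. As `∫ v = 0`, these are of the order of the tails, like `β`
itself. Convolution with `O(lam n / n)` preserves the order of the tails
(`IsDoublingWeight.convolution_le`). -/

/-! ### Absolutely summable power series over a Banach algebra -/

/-- In a complex Banach algebra with a central element `x` of norm at most one, every proper left
ideal is contained in a closed proper left ideal containing `x - z` for some `‖z‖ ≤ 1`. -/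
theorem exists_closed_ideal_sub_mem {R : Type*} [NormedRing R] [NormedAlgebra ℂ R]
    [CompleteSpace R] {x : R} (hx : ∀ a, a * x = x * a) (hx1 : ‖x‖ ≤ 1) {I : Ideal R}
    (hI : I ≠ ⊤) :
    ∃ L : Ideal R, I ≤ L ∧ L ≠ ⊤ ∧ IsClosed (L : Set R) ∧
      ∃ z : ℂ, ‖z‖ ≤ 1 ∧ x - algebraMap ℂ R z ∈ L := by
  obtain ⟨L, hL, hIL⟩ := Ideal.exists_le_maximal I hI
  have hcl : IsClosed (L : Set R) := Ideal.IsMaximal.isClosed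
  refine ⟨L, hIL, hL.ne_top, hcl, ?_⟩
  have : IsSimpleModule R (R ⧸ L) := isSimpleModule_iff_isCoatom.2 hL.out
  have : Nontrivial (R ⧸ L) := Submodule.Quotient.nontrivial_iff.2 hL.ne_top
  -- multiplication by `x - z` as an `R`-linear endomorphism of the quotient
  have hcomm : ∀ (z : ℂ) (a : R), a * (x - algebraMap ℂ R z) = (x - algebraMap ℂ R z) * a := by
    intro z a
    rw [mul_sub, sub_mul, hx, Algebra.commutes]
  let m : ℂ → (R ⧸ L) →ₗ[R] (R ⧸ L) := fun z =>
    { toFun := fun v => (x - algebraMap ℂ R z) • v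
      map_add' := fun v w => smul_add _ v w
      map_smul' := fun a v => by simp only [RingHom.id_apply, ← mul_smul, hcomm] }
  have hxn : ∀ v : R ⧸ L, ‖x • v‖ ≤ 1 * ‖v‖ := by
    intro v
    rw [one_mul]
    refine le_of_forall_pos_le_add fun ε hε => ?_
    obtain ⟨a, rfl, ha⟩ := Submodule.Quotient.norm_mk_lt (S := L) v hε
    calc ‖x • (Submodule.Quotient.mk a : R ⧸ L)‖
        = ‖(Submodule.Quotient.mk (x * a) : R ⧸ L)‖ := rfl
      _ ≤ ‖x * a‖ := Submodule.Quotient.norm_mk_le L _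
      _ ≤ ‖x‖ * ‖a‖ := norm_mul_le _ _
      _ ≤ 1 * ‖a‖ := by gcongr
      _ ≤ _ := by rw [one_mul]; exact ha.le
  let X : (R ⧸ L) →L[ℂ] (R ⧸ L) := LinearMap.mkContinuous
    { toFun := fun v => x • v
      map_add' := fun v w => smul_add _ v w
      map_smul' := fun c v => by
        simp only [RingHom.id_apply]
        rw [← algebraMap_smul R c v, ← algebraMap_smul R c (x • v), ← mul_smul, ← mul_smul,
          Algebra.commutes] } 1 hxn
  -- A noncommutative substitute for Gelfand theory: `x` is central, so it acts on the simple module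
  -- `R ⧸ L` by module endomorphisms. At a spectral value `z` the map `x - z` is not bijective,
  -- hence is zero by Schur's lemma.
  obtain ⟨z, hz⟩ := spectrum.nonempty X
  refine ⟨z, (spectrum.norm_le_norm_of_mem hz).trans
    (LinearMap.mkContinuous_norm_le _ zero_le_one _), ?_⟩
  have hm : ∀ v, m z v = (X - algebraMap ℂ _ z) v := by
    intro v
    change (x - algebraMap ℂ R z) • v = x • v - _
    rw [sub_smul, algebraMap_smul]
    rfl
  have h0 : m z = 0 := by
    rcases LinearMap.bijective_or_eq_zero (m z) with hb | h0
    · exfalso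
      apply hz
      have : IsUnit (X - algebraMap ℂ _ z) := by
        rw [ContinuousLinearMap.isUnit_iff_bijective]
        have : ⇑(X - algebraMap ℂ _ z) = ⇑(m z) := funext fun v => (hm v).symm
        rw [this]
        exact hb
      rw [← IsUnit.neg_iff, neg_sub] at this
      exact this
    · exact h0
  have h1 : m z (Submodule.Quotient.mk 1) = 0 := by rw [h0]; rfl
  have h2 : (Submodule.Quotient.mk ((x - algebraMap ℂ R z) * 1) : R ⧸ L) = 0 := h1
  rw [mul_one] at h2
  exact (Submodule.Quotient.mk_eq_zero L).1 h2

section SummableSeries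

theorem PowerSeries.summable_norm_coeff_mul {A : Type*} [NormedRing A] {f g : PowerSeries A}
    (hf : Summable fun n => ‖f.coeff n‖) (hg : Summable fun n => ‖g.coeff n‖) :
    Summable fun n => ‖(f * g).coeff n‖ := by
  have := summable_norm_sum_mul_antidiagonal_of_summable_norm hf hg
  simpa only [PowerSeries.coeff_mul] using this

variable {A : Type*} [NormedRing A] [NormedAlgebra ℂ A]

variable (A) in
/-- The algebra of power series with absolutely summable coefficients. -/
noncomputable def summableSeries : Subalgebra ℂ (PowerSeries A) where
  carrier := {f | Summable fun n => ‖f.coeff n‖}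
  mul_mem' := PowerSeries.summable_norm_coeff_mul
  add_mem' := fun {f g} (hf : Summable _) (hg : Summable _) => by
    refine Summable.of_nonneg_of_le (fun _ => norm_nonneg _) (fun n => ?_) (hf.add hg)
    simpa using norm_add_le (f.coeff n) (g.coeff n)
  algebraMap_mem' := fun c => by
    refine summable_of_ne_finset_zero (s := {0}) fun n hn => ?_
    have : n ≠ 0 := by simpa using hn
    simp [PowerSeries.algebraMap_apply, PowerSeries.coeff_C, this]

namespace summableSeries

theorem summable (f : summableSeries A) : Summable fun n => ‖(f : PowerSeries A).coeff n‖ := f.2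

noncomputable instance : Norm (summableSeries A) :=
  ⟨fun f => ∑' n, ‖(f : PowerSeries A).coeff n‖⟩

theorem norm_def (f : summableSeries A) : ‖f‖ = ∑' n, ‖(f : PowerSeries A).coeff n‖ := rfl

theorem norm_coeff_le (f : summableSeries A) (n : ℕ) : ‖(f : PowerSeries A).coeff n‖ ≤ ‖f‖ :=
  (summable f).le_tsum n fun _ _ => norm_nonneg _

noncomputable instance : NormedAddCommGroup (summableSeries A) :=
  AddGroupNorm.toNormedAddCommGroup
    { toFun := fun f => ‖f‖
      map_zero' := by simp [norm_def]
      add_le' := fun f g => by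
        rw [norm_def, norm_def, norm_def, ← (summable f).tsum_add (summable g)]
        refine (summable (f + g)).tsum_le_tsum (fun n => ?_) ((summable f).add (summable g))
        simpa using norm_add_le ((f : PowerSeries A).coeff n) ((g : PowerSeries A).coeff n)
      neg' := fun f => by simp [norm_def]
      eq_zero_of_map_eq_zero' := fun f hf => by
        refine Subtype.ext (PowerSeries.ext fun n => ?_)
        have := norm_coeff_le f n
        rw [hf] at this
        simpa using this }

noncomputable instance : NormedRing (summableSeries A) :=
  { (inferInstance : Ring (summableSeries A)),
    (inferInstance : NormedAddCommGroup (summableSeries A)) with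
    norm_mul_le := fun f g => by
      rw [norm_def f, norm_def g,
        tsum_mul_tsum_eq_tsum_sum_antidiagonal_of_summable_norm' (f := fun n => ‖(f : PowerSeries A).coeff n‖)
          (g := fun n => ‖(g : PowerSeries A).coeff n‖) (by simpa using summable f) (summable f)
          (by simpa using summable g) (summable g)]
      have hs := summable_norm_sum_mul_antidiagonal_of_summable_norm
        (f := fun n => ‖(f : PowerSeries A).coeff n‖) (g := fun n => ‖(g : PowerSeries A).coeff n‖)
        (by simpa using summable f) (by simpa using summable g)
      refine (summable (f * g)).tsum_le_tsum (fun n => ?_) hs.of_norm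
      change ‖((f : PowerSeries A) * (g : PowerSeries A)).coeff n‖ ≤ _
      rw [PowerSeries.coeff_mul]
      exact norm_sum_le_of_le _ fun p _ => norm_mul_le _ _ }

noncomputable instance : NormedAlgebra ℂ (summableSeries A) :=
  { (inferInstance : Algebra ℂ (summableSeries A)) with
    norm_smul_le := fun c f => by
      rw [norm_def, norm_def, ← tsum_mul_left]
      refine le_of_eq (tsum_congr fun n => ?_)
      simp [norm_smul] }

/-- Taking coefficients is an isometry onto `lp (fun _ => A) 1`, from which completeness is
transported. -/
instance [CompleteSpace A] : CompleteSpace (summableSeries A) := by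
  have hmem : ∀ f : summableSeries A, Memℓp (fun n => (f : PowerSeries A).coeff n) 1 := fun f => by
    rw [memℓp_gen_iff (by simp)]
    simpa using summable f
  let e : summableSeries A ≃ᵢ lp (fun _ : ℕ => A) 1 :=
    { toFun := fun f => ⟨fun n => (f : PowerSeries A).coeff n, hmem f⟩
      invFun := fun a => ⟨PowerSeries.mk a, by
        have := lp.memℓp a
        rw [memℓp_gen_iff (by simp)] at this
        change Summable _
        simpa using this⟩
      left_inv := fun f => Subtype.ext (PowerSeries.ext fun n => by simp)
      right_inv := fun a => lp.ext (funext fun n => by simp)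
      isometry_toFun := by
        refine Isometry.of_dist_eq fun f g => ?_
        rw [dist_eq_norm, dist_eq_norm, norm_def, lp.norm_eq_tsum_rpow (by simp)]
        simp only [ENNReal.toReal_one, Real.rpow_one, div_one]
        rfl }
  exact e.completeSpace_iff.2 inferInstance

end summableSeries

end SummableSeries

/-- Modulo `L` the element `x` may be evaluated at `z`: the geometric sum exhibits `x - z` as a
right factor of `x ^ n - z ^ n`, and a left ideal absorbs what stands to its left. -/
theorem Ideal.mul_pow_sub_smul_mem {K R : Type*} [CommRing K] [Ring R] [Algebra K R]
    (L : Ideal R) {x : R} {z : K} (h : x - algebraMap K R z ∈ L) (a : R) (n : ℕ) :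
    a * x ^ n - z ^ n • a ∈ L := by
  have : a * x ^ n - z ^ n • a =
      a * (∑ i ∈ Finset.range n, x ^ i * algebraMap K R z ^ (n - 1 - i)) *
        (x - algebraMap K R z) := by
    rw [mul_assoc, Commute.geom_sum₂_mul (Algebra.commutes z x).symm, mul_sub, ← map_pow,
      ← Algebra.commutes, ← Algebra.smul_def]
  rw [this]
  exact L.mul_mem_left _ h

/-! ### Wiener's lemma on the closed disk -/

section Wiener

variable {A : Type*} [NormedRing A] [NormedAlgebra ℂ A]

namespace summableSeries

/-- The constant series. -/
noncomputable def const (a : A) : summableSeries A :=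
  ⟨PowerSeries.C a, by
    refine summable_of_ne_finset_zero (s := {0}) fun n hn => ?_
    have : n ≠ 0 := by simpa using hn
    simp [PowerSeries.coeff_C, this]⟩

/-- The variable, as a summable series. -/
noncomputable def X : summableSeries A :=
  ⟨PowerSeries.X, by
    refine summable_of_ne_finset_zero (s := {1}) fun n hn => ?_
    have : n ≠ 1 := by simpa using hn
    simp [PowerSeries.coeff_X, this]⟩

theorem coe_const_mul_X_pow (a : A) (n : ℕ) :
    ((const a * X ^ n : summableSeries A) : PowerSeries A) = PowerSeries.monomial n a := by
  change PowerSeries.C a * PowerSeries.X ^ n = _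
  exact (PowerSeries.monomial_eq_C_mul_X_pow _ _).symm

theorem norm_const_mul_X_pow (a : A) (n : ℕ) : ‖(const a * X ^ n : summableSeries A)‖ = ‖a‖ := by
  rw [norm_def, tsum_eq_single n]
  · rw [coe_const_mul_X_pow]; simp
  · intro k hk
    rw [coe_const_mul_X_pow]; simp [PowerSeries.coeff_monomial, hk]

theorem norm_const (a : A) : ‖(const a : summableSeries A)‖ = ‖a‖ := by
  simpa using norm_const_mul_X_pow a 0

theorem mul_X (a : summableSeries A) : a * X = X * a :=
  Subtype.ext (PowerSeries.commute_X (a : PowerSeries A)).eq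

/-- The coefficients are continuous linear functions of the series. -/
noncomputable def coeffL (n : ℕ) : summableSeries A →L[ℂ] A :=
  LinearMap.mkContinuous
    { toFun := fun f => (f : PowerSeries A).coeff n
      map_add' := fun f g => by simp
      map_smul' := fun c f => by simp } 1 fun f => by simpa using norm_coeff_le f n

/-- The constant series form a closed subalgebra. -/
noncomputable def constL : A →L[ℂ] summableSeries A :=
  LinearMap.mkContinuous
    { toFun := const
      map_add' := fun a b => Subtype.ext (map_add PowerSeries.C a b)
      map_smul' := fun c a => Subtype.ext (PowerSeries.ext fun n => by
        by_cases h : n = 0 <;> simp [const, PowerSeries.coeff_C, h]) } 1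
    fun a => by simpa using (norm_const a).le

theorem hasSum_const_mul_X_pow [CompleteSpace A] (f : summableSeries A) :
    HasSum (fun n => const ((f : PowerSeries A).coeff n) * X ^ n) f := by
  have hs : Summable fun n => const ((f : PowerSeries A).coeff n) * X ^ n := by
    refine Summable.of_norm ?_
    simpa only [norm_const_mul_X_pow] using summable f
  convert hs.hasSum
  refine Subtype.ext (PowerSeries.ext fun k => ?_)
  change _ = coeffL k _
  rw [(coeffL k).map_tsum hs, tsum_eq_single k]
  · change _ = ((const _ * X ^ k : summableSeries A) : PowerSeries A).coeff k
    rw [coe_const_mul_X_pow]; simp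
  · intro n hn
    change ((const _ * X ^ n : summableSeries A) : PowerSeries A).coeff k = 0
    rw [coe_const_mul_X_pow]; simp [PowerSeries.coeff_monomial, hn.symm]

/-- **Wiener's lemma** on the closed disk: a summable power series with values in a Banach algebra
that takes invertible values on the closed unit disk has a left inverse with summable
coefficients. -/
theorem exists_mul_eq_one [CompleteSpace A] [NormOneClass A] (f : summableSeries A)
    (hf : ∀ z : ℂ, ‖z‖ ≤ 1 → IsUnit (∑' n, z ^ n • (f : PowerSeries A).coeff n)) :
    ∃ g : summableSeries A, g * f = 1 := by
  by_contra hcon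
  have hI : Ideal.span {f} ≠ ⊤ := by
    intro h
    apply hcon
    have h1 : (1 : summableSeries A) ∈ Ideal.span {f} := by rw [h]; trivial
    obtain ⟨g, hg⟩ := Ideal.mem_span_singleton'.1 h1
    exact ⟨g, hg⟩
  have h1 : (const 1 : summableSeries A) = 1 := Subtype.ext (map_one PowerSeries.C)
  have hX : ‖(X : summableSeries A)‖ ≤ 1 := by
    have := norm_const_mul_X_pow (1 : A) 1
    rw [h1, one_mul, pow_one] at this
    rw [this, norm_one]
  obtain ⟨L, hIL, hL, hcl, z, hz, hzL⟩ := exists_closed_ideal_sub_mem mul_X hX hI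
  have hfL : f ∈ L := hIL (Ideal.subset_span rfl)
  have hs : Summable fun n => z ^ n • (f : PowerSeries A).coeff n := by
    refine Summable.of_norm_bounded (summable f) fun n => ?_
    rw [norm_smul, norm_pow]
    exact mul_le_of_le_one_left (norm_nonneg _) (pow_le_one₀ (norm_nonneg _) hz)
  -- Evaluation at `z` holds modulo `L` for each monomial, and passes to the infinite sum because
  -- `L` is closed. So the constant `f(z)`, a unit, lies in the proper ideal `L`.
  have hval : f - constL (∑' n, z ^ n • (f : PowerSeries A).coeff n) ∈ L := by
    have hsum := (hasSum_const_mul_X_pow f).sub (constL.hasSum hs.hasSum)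
    refine hcl.mem_of_tendsto hsum (Eventually.of_forall fun s => L.sum_mem fun n _ => ?_)
    rw [map_smul]
    exact L.mul_pow_sub_smul_mem hzL _ n
  have hc : const (∑' n, z ^ n • (f : PowerSeries A).coeff n) ∈ L := by
    have := L.sub_mem hfL hval
    rwa [sub_sub_cancel] at this
  obtain ⟨u, hu⟩ := hf z hz
  apply hL
  rw [Ideal.eq_top_iff_one, ← h1, ← u.inv_mul]
  have : const (((u⁻¹ : Aˣ) : A) * u) = const ((u⁻¹ : Aˣ) : A) * const (u : A) :=
    Subtype.ext (map_mul PowerSeries.C _ _)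
  rw [this, hu]
  exact L.mul_mem_left _ hc

end summableSeries
end Wiener

/-! ### Doubling weights and the bootstrap -/

/-- A positive decreasing doubling sequence `lam → 0` for which `lam n / n` is summable. -/
structure IsDoublingWeight (lam : ℕ → ℝ) : Prop where
  pos : ∀ n, 0 < lam n
  anti : Antitone lam
  half : ∃ D, 0 < D ∧ ∀ n, lam (n / 2) ≤ D * lam n
  tendsto : Tendsto lam atTop (𝓝 0)
  summable : Summable fun n : ℕ => lam n / n

theorem PowerSeries.coeff_mul_le_coeff_mul {a b c d : PowerSeries ℝ} {n : ℕ}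
    (hab : ∀ k ≤ n, coeff k a ≤ coeff k b) (hcd : ∀ k ≤ n, coeff k c ≤ coeff k d)
    (hc : ∀ k, 0 ≤ coeff k c) (hb : ∀ k, 0 ≤ coeff k b) :
    coeff n (a * c) ≤ coeff n (b * d) := by
  rw [coeff_mul, coeff_mul]
  refine Finset.sum_le_sum fun p hp => ?_
  have := Finset.HasAntidiagonal.mem_antidiagonal.1 hp
  exact mul_le_mul (hab _ (by omega)) (hcd _ (by omega)) (hc _) (hb _)

theorem PowerSeries.coeff_mul_nonneg {a b : PowerSeries ℝ} (ha : ∀ k, 0 ≤ coeff k a)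
    (hb : ∀ k, 0 ≤ coeff k b) (n : ℕ) : 0 ≤ coeff n (a * b) := by
  rw [coeff_mul]
  exact Finset.sum_nonneg fun p _ => mul_nonneg (ha _) (hb _)

theorem summable_coeff_mul_of_nonneg {a b : PowerSeries ℝ} (ha : ∀ k, 0 ≤ a.coeff k)
    (hb : ∀ k, 0 ≤ b.coeff k) (hsa : Summable fun n => a.coeff n)
    (hsb : Summable fun n => b.coeff n) : Summable fun n => (a * b).coeff n := by
  refine Summable.of_norm (PowerSeries.summable_norm_coeff_mul ?_ ?_)
  · simpa only [Real.norm_of_nonneg (ha _)] using hsa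
  · simpa only [Real.norm_of_nonneg (hb _)] using hsb

/-- The convolution of a summable sequence with a null sequence is a null sequence. -/
theorem tendsto_coeff_mul_of_summable {a : ℕ → ℝ} (ha : ∀ n, 0 ≤ a n) (hs : Summable a)
    {lam : ℕ → ℝ} (h : IsDoublingWeight lam) :
    Tendsto (fun n => (PowerSeries.mk a * PowerSeries.mk lam).coeff n) atTop (𝓝 0) := by
  have hhalf : Tendsto (fun n : ℕ => n / 2) atTop atTop := Nat.tendsto_div_const_atTop (by norm_num)
  have hub : Tendsto (fun n : ℕ => (∑' i, a i) * lam (n / 2) + lam 0 * ∑' i, a (i + n / 2))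
      atTop (𝓝 0) := by
    have h1 := (h.tendsto.comp hhalf).const_mul (∑' i, a i)
    have h2 := ((tendsto_sum_nat_add a).comp hhalf).const_mul (lam 0)
    simpa using h1.add h2
  refine squeeze_zero (fun n => PowerSeries.coeff_mul_nonneg (by simpa using ha)
    (by simpa using fun k => (h.pos k).le) n) (fun n => ?_) hub
  rw [PowerSeries.coeff_mul]
  -- Split at `n / 2`: either the index of `lam` is large, or that of `a` is and a tail of a
  -- convergent series appears.
  have hle : ∀ p ∈ Finset.HasAntidiagonal.antidiagonal n,
      (PowerSeries.mk a).coeff p.1 * (PowerSeries.mk lam).coeff p.2 ≤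
        a p.1 * lam (n / 2) + lam 0 * (if n / 2 ≤ p.1 then a p.1 else 0) := by
    intro p hp
    have hp' := Finset.HasAntidiagonal.mem_antidiagonal.1 hp
    simp only [PowerSeries.coeff_mk]
    split_ifs with hn
    · have := mul_le_mul_of_nonneg_left (h.anti (Nat.zero_le p.2)) (ha p.1)
      have := mul_nonneg (ha p.1) (h.pos (n / 2)).le
      linarith
    · have := mul_le_mul_of_nonneg_left (h.anti (show n / 2 ≤ p.2 by omega)) (ha p.1)
      linarith
  refine (Finset.sum_le_sum hle).trans ?_
  rw [Finset.sum_add_distrib, ← Finset.sum_mul, ← Finset.mul_sum,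
    Finset.Nat.sum_antidiagonal_eq_sum_range_succ (fun i _ => a i),
    Finset.Nat.sum_antidiagonal_eq_sum_range_succ (fun i _ => if n / 2 ≤ i then a i else 0)]
  gcongr
  · exact (h.pos _).le
  · exact hs.sum_le_tsum _ fun i _ => ha i
  · exact (h.pos _).le
  · rw [← Finset.sum_filter]
    have : (Finset.range n.succ).filter (fun i => n / 2 ≤ i) ⊆
        (Finset.range n.succ).image (fun i => i + n / 2) := by
      intro i hi
      simp only [Finset.mem_filter, Finset.mem_range] at hi
      exact Finset.mem_image.2 ⟨i - n / 2, by simp only [Finset.mem_range]; omega, by omega⟩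
    refine (Finset.sum_le_sum_of_subset_of_nonneg this fun i _ _ => ha i).trans ?_
    rw [Finset.sum_image (by intro x _ y _ hxy; simpa using hxy)]
    exact ((summable_nat_add_iff _).2 hs).sum_le_tsum _ fun i _ => ha _

/-- Bootstrapping: a summable nonnegative sequence with `n aₙ ≤ C (a * lam * a)ₙ` satisfies
`n aₙ = O(lam n)`. -/
theorem IsDoublingWeight.bootstrap {lam : ℕ → ℝ} (h : IsDoublingWeight lam) {a : ℕ → ℝ}
    (ha : ∀ n, 0 ≤ a n) (hs : Summable a) {C : ℝ} (hC : 0 ≤ C)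
    (hle : ∀ n : ℕ, n * a n ≤
      C * (PowerSeries.mk a * PowerSeries.mk lam * PowerSeries.mk a).coeff n) :
    ∃ K, 0 ≤ K ∧ ∀ n : ℕ, n * a n ≤ K * lam n := by
  obtain ⟨D, hD, hhalf⟩ := h.half
  set g : ℕ → ℝ := fun n => (PowerSeries.mk a * PowerSeries.mk lam).coeff n with hg
  have hg0 : ∀ n, 0 ≤ g n := PowerSeries.coeff_mul_nonneg (by simpa using ha)
    (by simpa using fun k => (h.pos k).le)
  set P : ℝ := ∑' n, (PowerSeries.mk a * PowerSeries.mk a).coeff n with hP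
  have hsP : Summable fun n => (PowerSeries.mk a * PowerSeries.mk a).coeff n :=
    summable_coeff_mul_of_nonneg (by simpa using ha) (by simpa using ha) (by simpa using hs)
      (by simpa using hs)
  have hp0 : ∀ n, 0 ≤ (PowerSeries.mk a * PowerSeries.mk a).coeff n :=
    PowerSeries.coeff_mul_nonneg (by simpa using ha) (by simpa using ha)
  have hP0 : 0 ≤ P := tsum_nonneg hp0
  -- Cut `a = a₁ + a₂` at index `n / 4`. In `a₁ * a₁ * lam` the weight has index at least `n / 2`.
  -- Every other term contains a factor `a` of index above `n / 4`, which the induction hypothesis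
  -- will control; there are two such families, hence the factor 2.
  have hmain : ∀ n, (PowerSeries.mk a * PowerSeries.mk lam * PowerSeries.mk a).coeff n ≤
      P * lam (n / 2) +
        2 * ∑ p ∈ Finset.HasAntidiagonal.antidiagonal n, (if n < 4 * p.1 then a p.1 else 0) * g p.2 := by
    intro n
    set a₁ : PowerSeries ℝ := PowerSeries.mk fun i => if n < 4 * i then 0 else a i with ha₁
    set a₂ : PowerSeries ℝ := PowerSeries.mk fun i => if n < 4 * i then a i else 0 with ha₂
    set l := PowerSeries.mk lam with hl
    have hl0 : ∀ k, 0 ≤ l.coeff k := by simpa [hl] using fun k => (h.pos k).le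
    have ha10 : ∀ k, 0 ≤ a₁.coeff k := fun k => by
      simp only [ha₁, PowerSeries.coeff_mk]; split_ifs; exacts [le_rfl, ha k]
    have ha20 : ∀ k, 0 ≤ a₂.coeff k := fun k => by
      simp only [ha₂, PowerSeries.coeff_mk]; split_ifs; exacts [ha k, le_rfl]
    have ha1 : ∀ k, a₁.coeff k ≤ a k := fun k => by
      simp only [ha₁, PowerSeries.coeff_mk]; split_ifs; exacts [ha k, le_rfl]
    have hsplit : PowerSeries.mk a = a₁ + a₂ := PowerSeries.ext fun k => by
      simp only [ha₁, ha₂, map_add, PowerSeries.coeff_mk]; split_ifs <;> simp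
    have e1 : PowerSeries.mk a * l * PowerSeries.mk a =
        a₁ * a₁ * l + a₁ * (a₂ * l) + a₂ * (PowerSeries.mk a * l) := by
      rw [hsplit]; ring
    have b1 : (a₁ * a₁ * l).coeff n ≤ P * lam (n / 2) := by
      rw [PowerSeries.coeff_mul]
      have : ∀ p ∈ Finset.HasAntidiagonal.antidiagonal n, (a₁ * a₁).coeff p.1 * l.coeff p.2 ≤
          (PowerSeries.mk a * PowerSeries.mk a).coeff p.1 * lam (n / 2) := by
        intro p hp
        have hp' := Finset.HasAntidiagonal.mem_antidiagonal.1 hp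
        by_cases hpn : n < 2 * p.1
        · have : (a₁ * a₁).coeff p.1 = 0 := by
            rw [PowerSeries.coeff_mul]
            refine Finset.sum_eq_zero fun q hq => ?_
            have hq' := Finset.HasAntidiagonal.mem_antidiagonal.1 hq
            simp only [ha₁, PowerSeries.coeff_mk]
            rcases (show n < 4 * q.1 ∨ n < 4 * q.2 by omega) with hh | hh <;> simp [hh]
          rw [this, zero_mul]
          exact mul_nonneg (hp0 _) (h.pos _).le
        · refine mul_le_mul ?_ ?_ (hl0 _) (hp0 _)
          · exact PowerSeries.coeff_mul_le_coeff_mul (by simpa using fun k _ => ha1 k)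
              (by simpa using fun k _ => ha1 k) ha10 (by simpa using ha)
          · simp only [hl, PowerSeries.coeff_mk]
            exact h.anti (by omega)
      refine (Finset.sum_le_sum this).trans ?_
      rw [← Finset.sum_mul, Finset.Nat.sum_antidiagonal_eq_sum_range_succ
        (fun i _ => (PowerSeries.mk a * PowerSeries.mk a).coeff i)]
      exact mul_le_mul_of_nonneg_right (hsP.sum_le_tsum _ fun i _ => hp0 i) (h.pos _).le
    have b3 : (a₂ * (PowerSeries.mk a * l)).coeff n =
        ∑ p ∈ Finset.HasAntidiagonal.antidiagonal n, (if n < 4 * p.1 then a p.1 else 0) * g p.2 := by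
      rw [PowerSeries.coeff_mul]
      simp [ha₂, hg]
    have b2 : (a₁ * (a₂ * l)).coeff n ≤ (a₂ * (PowerSeries.mk a * l)).coeff n := by
      rw [show a₂ * (PowerSeries.mk a * l) = PowerSeries.mk a * (a₂ * l) by ring]
      exact PowerSeries.coeff_mul_le_coeff_mul (by simpa using fun k _ => ha1 k)
        (fun _ _ => le_rfl) (PowerSeries.coeff_mul_nonneg ha20 hl0) (by simpa using ha)
    rw [e1, map_add, map_add, ← b3]
    linarith
  -- the Cesàro means of `g` tend to zero
  have hces : Tendsto (fun n : ℕ => (n : ℝ)⁻¹ * ∑ i ∈ Finset.range (n + 1), g i) atTop (𝓝 0) := by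
    have ht := tendsto_coeff_mul_of_summable ha hs h
    have h1 := ht.cesaro
    have h2 : Tendsto (fun n : ℕ => (n : ℝ)⁻¹ * g n) atTop (𝓝 0) := by
      simpa using tendsto_inv_atTop_nhds_zero_nat.mul ht
    have h3 := h1.add h2
    simp only [add_zero] at h3
    refine h3.congr fun n => ?_
    rw [Finset.sum_range_succ, mul_add]
  -- Beyond the threshold, the inductive contribution is at most a quarter of `K * lam n`, and the
  -- self-referential term `2 * C * g 0 * a n` is absorbed in half of the left side `n * a n`.
  have hev : ∀ᶠ n : ℕ in atTop, 0 < n ∧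
      8 * C * D ^ 2 * ((n : ℝ)⁻¹ * ∑ i ∈ Finset.range (n + 1), g i) ≤ 1 / 4 ∧
      2 * C * g 0 ≤ n / 2 := by
    refine (eventually_gt_atTop 0).and (Eventually.and ?_ ?_)
    · have := hces.const_mul (8 * C * D ^ 2)
      rw [mul_zero] at this
      exact this.eventually_le_const (by norm_num)
    · filter_upwards [tendsto_natCast_atTop_atTop.eventually_ge_atTop (2 * (2 * C * g 0))] with n hn
      linarith
  obtain ⟨n₀, hn₀⟩ := eventually_atTop.1 hev
  -- The first summand closes the inequality `n * a n / 2 ≤ (C * P * D + K / 4) * lam n`; the finite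
  -- sum covers the indices below `n₀`.
  set K : ℝ := 4 * C * P * D + ∑ i ∈ Finset.range n₀, i * a i / lam i with hK
  have hK0 : 0 ≤ ∑ i ∈ Finset.range n₀, i * a i / lam i := Finset.sum_nonneg fun i _ =>
    div_nonneg (mul_nonneg (Nat.cast_nonneg _) (ha i)) (h.pos i).le
  have hK1 : 4 * C * P * D ≤ K := by linarith
  have hKn : 0 ≤ K := by positivity
  refine ⟨K, hKn, fun n => ?_⟩
  induction n using Nat.strong_induction_on with
  | _ n ih =>
  by_cases hn : n < n₀
  · rw [← div_le_iff₀ (h.pos n)]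
    have := Finset.single_le_sum (f := fun i : ℕ => i * a i / lam i) (fun i _ =>
      div_nonneg (mul_nonneg (Nat.cast_nonneg _) (ha i)) (h.pos i).le) (Finset.mem_range.2 hn)
    have h4 : 0 ≤ 4 * C * P * D := by positivity
    linarith
  · obtain ⟨hn1, hn2, hn3⟩ := hn₀ n (not_lt.1 hn)
    have hnpos : (0 : ℝ) < n := Nat.cast_pos.2 hn1
    have hlam4 : lam (n / 4) ≤ D ^ 2 * lam n := by
      rw [show n / 4 = n / 2 / 2 by omega]
      calc lam (n / 2 / 2) ≤ D * lam (n / 2) := hhalf _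
        _ ≤ D * (D * lam n) := by gcongr; exact hhalf n
        _ = _ := by ring
    have hsum : ∑ p ∈ Finset.HasAntidiagonal.antidiagonal n, (if n < 4 * p.1 then a p.1 else 0) * g p.2 ≤
        4 * K * D ^ 2 * lam n * ((n : ℝ)⁻¹ * ∑ i ∈ Finset.range (n + 1), g i) + a n * g 0 := by
      -- The pair `(n, 0)` is kept apart because it involves `a n` itself, to which induction does
      -- not apply.
      have hterm : ∀ p ∈ Finset.HasAntidiagonal.antidiagonal n, (if n < 4 * p.1 then a p.1 else 0) * g p.2 ≤
          4 * K * D ^ 2 * lam n * (n : ℝ)⁻¹ * g p.2 + (if p = (n, 0) then a n * g 0 else 0) := by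
        intro p hp
        have hp' := Finset.HasAntidiagonal.mem_antidiagonal.1 hp
        have hnn : 0 ≤ 4 * K * D ^ 2 * lam n * (n : ℝ)⁻¹ * g p.2 := by
          have := h.pos n
          have := hg0 p.2
          positivity
        by_cases hpn : p = (n, 0)
        · rw [if_pos hpn, hpn, if_pos (by simp only; omega)]
          rw [hpn] at hnn
          simpa using hnn
        · rw [if_neg hpn, add_zero]
          split_ifs with h4
          · refine mul_le_mul_of_nonneg_right ?_ (hg0 _)
            have hlt : p.1 < n := by
              rcases Nat.lt_or_ge p.1 n with hh | hh
              · exact hh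
              · exact absurd (Prod.ext (by omega) (by simp only; omega)) hpn
            have h5 := ih p.1 hlt
            have h6 : lam p.1 ≤ D ^ 2 * lam n := (h.anti (by omega)).trans hlam4
            have h7 : (n : ℝ) ≤ 4 * p.1 := by exact_mod_cast h4.le
            rw [← div_eq_mul_inv, le_div_iff₀ hnpos]
            calc a p.1 * n ≤ a p.1 * (4 * p.1) := by gcongr; exact ha _
              _ = 4 * (p.1 * a p.1) := by ring
              _ ≤ 4 * (K * lam p.1) := by gcongr
              _ ≤ 4 * (K * (D ^ 2 * lam n)) := by gcongr
              _ = _ := by ring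
          · simpa using hnn
      refine (Finset.sum_le_sum hterm).trans ?_
      rw [Finset.sum_add_distrib, ← Finset.mul_sum]
      refine add_le_add (le_of_eq ?_) ?_
      · rw [← Finset.Nat.sum_antidiagonal_swap, Finset.Nat.sum_antidiagonal_eq_sum_range_succ_mk]
        simp only [Prod.snd_swap]
        ring
      · rw [Finset.sum_ite_eq' (Finset.HasAntidiagonal.antidiagonal n) (n, 0)]
        simp
    have h1 := (hle n).trans (mul_le_mul_of_nonneg_left (hmain n) hC)
    have h2 := mul_le_mul_of_nonneg_left hsum (mul_nonneg zero_le_two hC)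
    have h3 : C * (P * lam (n / 2)) ≤ C * (P * (D * lam n)) := by gcongr; exact hhalf n
    have h4 := mul_le_mul_of_nonneg_left hn2 (mul_nonneg hKn (h.pos n).le)
    have h5 := mul_le_mul_of_nonneg_left hn3 (ha n)
    have h6 := mul_le_mul_of_nonneg_right hK1 (h.pos n).le
    nlinarith

/-! ### Differentiating the inverse series -/

section LogDerivative

variable {A : Type*} [Ring A]

/-- The Euler derivation `∑ aₙ xⁿ ↦ ∑ n aₙ xⁿ`. -/
noncomputable def PowerSeries.euler (f : PowerSeries A) : PowerSeries A :=
  PowerSeries.mk fun n => (n : A) * f.coeff n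

theorem PowerSeries.euler_mul (f g : PowerSeries A) :
    (f * g).euler = f.euler * g + f * g.euler := by
  ext n
  simp only [euler, coeff_mk, coeff_mul, map_add, Finset.mul_sum]
  rw [← Finset.sum_add_distrib]
  refine Finset.sum_congr rfl fun p hp => ?_
  rw [← Finset.HasAntidiagonal.mem_antidiagonal.1 hp, Nat.cast_add, add_mul, mul_assoc,
    ← mul_assoc (p.2 : A), (Nat.cast_commute p.2 (coeff p.1 f)).eq, mul_assoc]

/-- Leibniz' rule applied to `g * f = 1`, in a possibly noncommutative ring. It expresses `n gₙ`
through `g` twice and `k fₖ` once, which is the input of the bootstrap. -/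
theorem PowerSeries.euler_of_mul_eq_one {f g : PowerSeries A} (h : g * f = 1) (h' : f * g = 1) :
    g.euler = -(g * f.euler * g) := by
  have h1 : (g * f).euler = 0 := by
    rw [h]
    ext n
    by_cases hn : n = 0 <;> simp [euler, coeff_one, hn]
  rw [euler_mul] at h1
  calc g.euler = g.euler * f * g := by rw [mul_assoc, h', mul_one]
    _ = _ := by rw [eq_neg_of_add_eq_zero_left h1, neg_mul]

end LogDerivative

theorem PowerSeries.norm_coeff_mul_le {A : Type*} [NormedRing A] {f g : PowerSeries A}
    {a b : PowerSeries ℝ} (hf : ∀ n, ‖f.coeff n‖ ≤ a.coeff n) (hg : ∀ n, ‖g.coeff n‖ ≤ b.coeff n)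
    (n : ℕ) : ‖(f * g).coeff n‖ ≤ (a * b).coeff n := by
  rw [coeff_mul, coeff_mul]
  exact norm_sum_le_of_le _ fun p _ => (norm_mul_le _ _).trans
    (mul_le_mul (hf _) (hg _) (norm_nonneg _) ((norm_nonneg _).trans (hf _)))

/-- Weighted Wiener lemma: the inverse of a power series `1 + ∑ Mₙ xⁿ`, with coefficients
`Mₙ = O(lam n / n)` in a Banach algebra, that is invertible on the closed unit disk has
coefficients `O(lam n / n)`. -/
theorem IsDoublingWeight.exists_inverse {A : Type*} [NormedRing A] [NormedAlgebra ℂ A]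
    [CompleteSpace A] [NormOneClass A] {lam : ℕ → ℝ} (h : IsDoublingWeight lam) {M : ℕ → A}
    (hM0 : M 0 = 1) {C : ℝ} (hM : ∀ n, 1 ≤ n → ‖M n‖ ≤ C * (lam n / n))
    (hunit : ∀ z : ℂ, ‖z‖ ≤ 1 → IsUnit (∑' n, z ^ n • M n)) :
    ∃ N : PowerSeries A, N * PowerSeries.mk M = 1 ∧
      ∃ K, 0 ≤ K ∧ ∀ n, 1 ≤ n → ‖N.coeff n‖ ≤ K * (lam n / n) := by
  have hC : 0 ≤ C := by
    have h1 := (norm_nonneg _).trans (hM 1 le_rfl)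
    exact nonneg_of_mul_nonneg_left h1 (div_pos (h.pos 1) (by norm_num))
  have hsM : Summable fun n => ‖(PowerSeries.mk M).coeff n‖ := by
    refine (summable_nat_add_iff 1).1 (Summable.of_nonneg_of_le (fun _ => norm_nonneg _)
      (fun n => ?_) (((summable_nat_add_iff 1).2 h.summable).mul_left C))
    simpa using hM (n + 1) (by omega)
  obtain ⟨N, hN⟩ := summableSeries.exists_mul_eq_one (⟨PowerSeries.mk M, hsM⟩ : summableSeries A)
    (by simpa using hunit)
  have hNM : (N : PowerSeries A) * PowerSeries.mk M = 1 := congrArg Subtype.val hN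
  -- Wiener's lemma gives only a left inverse. A formal right inverse exists because the constant
  -- coefficient is `1`, and the two coincide.
  have hMN : PowerSeries.mk M * (N : PowerSeries A) = 1 := by
    have h1 : PowerSeries.mk M * PowerSeries.invOfUnit (PowerSeries.mk M) 1 = 1 :=
      PowerSeries.mul_invOfUnit _ _ (by
        rw [← PowerSeries.coeff_zero_eq_constantCoeff_apply]; simpa using hM0)
    rwa [left_inv_eq_right_inv hNM h1]
  have hle : ∀ n : ℕ, n * ‖(N : PowerSeries A).coeff n‖ ≤
      C * (PowerSeries.mk (fun n => ‖(N : PowerSeries A).coeff n‖) * PowerSeries.mk lam *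
        PowerSeries.mk fun n => ‖(N : PowerSeries A).coeff n‖).coeff n := by
    intro n
    have h1 := congrArg (fun f => ‖PowerSeries.coeff n f‖) (PowerSeries.euler_of_mul_eq_one hNM hMN)
    have h2 : ‖PowerSeries.coeff n (N : PowerSeries A).euler‖ =
        n * ‖(N : PowerSeries A).coeff n‖ := by
      rw [PowerSeries.euler, PowerSeries.coeff_mk, ← nsmul_eq_mul, ← Nat.cast_smul_eq_nsmul ℂ,
        norm_smul]
      simp
    simp only [h2, map_neg, norm_neg] at h1
    rw [h1, ← smul_eq_mul C, ← PowerSeries.coeff_smul, ← smul_mul_assoc, ← mul_smul_comm]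
    refine PowerSeries.norm_coeff_mul_le (PowerSeries.norm_coeff_mul_le (fun k => by simp)
      fun k => ?_) (fun k => by simp) n
    simp only [PowerSeries.euler, PowerSeries.coeff_mk, map_smul, smul_eq_mul]
    rcases Nat.eq_zero_or_pos k with rfl | hk
    · simpa using mul_nonneg hC (h.pos 0).le
    · rw [← nsmul_eq_mul, ← Nat.cast_smul_eq_nsmul ℂ, norm_smul]
      have hk' : (0 : ℝ) < k := Nat.cast_pos.2 hk
      calc ‖(k : ℂ)‖ * ‖M k‖ ≤ k * (C * (lam k / k)) := by
            rw [Complex.norm_natCast]; gcongr; exact hM k hk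
        _ = _ := by field_simp
  obtain ⟨K, hK, hKn⟩ := h.bootstrap (fun n => norm_nonneg _) N.2 hC hle
  refine ⟨N, hNM, K, hK, fun n hn => ?_⟩
  rw [mul_div_assoc', le_div_iff₀ (Nat.cast_pos.2 hn), mul_comm]
  exact hKn n

/-! ### Tails of the weight and convolution estimates -/

/-- The tails `∑_{j ≥ n} lam j / j`. -/
noncomputable def weightTail (lam : ℕ → ℝ) (n : ℕ) : ℝ := ∑' j, lam (j + n) / ((j + n : ℕ) : ℝ)

namespace IsDoublingWeight

theorem div_nonneg' {lam : ℕ → ℝ} (h : IsDoublingWeight lam) (n : ℕ) : 0 ≤ lam n / n :=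
  div_nonneg (h.pos n).le (Nat.cast_nonneg n)

theorem summable_add {lam : ℕ → ℝ} (h : IsDoublingWeight lam) (n : ℕ) :
    Summable fun j : ℕ => lam (j + n) / ((j + n : ℕ) : ℝ) :=
  (summable_nat_add_iff (f := fun j : ℕ => lam j / j) n).2 h.summable

theorem weightTail_succ {lam : ℕ → ℝ} (h : IsDoublingWeight lam) (n : ℕ) :
    weightTail lam n = lam n / n + weightTail lam (n + 1) := by
  rw [weightTail, (h.summable_add n).tsum_eq_zero_add, weightTail]
  simp only [zero_add]
  congr 1
  refine tsum_congr fun j => ?_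
  rw [show j + 1 + n = j + (n + 1) by omega]

theorem weightTail_anti {lam : ℕ → ℝ} (h : IsDoublingWeight lam) : Antitone (weightTail lam) :=
  antitone_nat_of_succ_le fun n => by
    have := h.weightTail_succ n
    have := h.div_nonneg' n
    linarith

theorem weightTail_nonneg {lam : ℕ → ℝ} (h : IsDoublingWeight lam) (n : ℕ) : 0 ≤ weightTail lam n :=
  tsum_nonneg fun _ => h.div_nonneg' _

theorem weightTail_pos {lam : ℕ → ℝ} (h : IsDoublingWeight lam) (n : ℕ) : 0 < weightTail lam n := by
  -- For `n = 0` the leading term `lam 0 / 0` is zero, so positivity is drawn from the term of index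
  -- `n + 1`.
  have h1 := h.weightTail_succ (n + 1)
  have h2 := h.weightTail_anti (Nat.le_succ n)
  have h3 := h.weightTail_nonneg (n + 1 + 1)
  have h4 : 0 < lam (n + 1) / ((n + 1 : ℕ) : ℝ) := div_pos (h.pos _) (by positivity)
  exact (by linarith : 0 < weightTail lam (n + 1)).trans_le h2

theorem weightTail_eq_sum_add {lam : ℕ → ℝ} (h : IsDoublingWeight lam) (n k : ℕ) : weightTail lam n =
    ∑ j ∈ Finset.range k, lam (j + n) / ((j + n : ℕ) : ℝ) + weightTail lam (n + k) := by
  rw [weightTail, ← (h.summable_add n).sum_add_tsum_nat_add k, weightTail]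
  congr 1
  refine tsum_congr fun j => ?_
  rw [show j + k + n = j + (n + k) by omega]

/-- The block from `n / 2` to `n` weighs at most `2 * lam (n / 2)`, which doubling bounds by a
multiple of `lam (2 * n)`, and the block from `n` to `2 * n` weighs at least half of the latter. The
quotient of tails in the constant serves `n < 2`, where `n / 2 = 0`. -/
theorem weightTail_half {lam : ℕ → ℝ} (h : IsDoublingWeight lam) :
    ∃ D, 0 < D ∧ ∀ n, weightTail lam (n / 2) ≤ D * weightTail lam n := by
  obtain ⟨D, hD, hhalf⟩ := h.half
  refine ⟨1 + 2 * (2 * D ^ 2) + weightTail lam 0 / weightTail lam 1, ?_, fun n => ?_⟩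
  · have := h.weightTail_pos 0
    have := h.weightTail_pos 1
    positivity
  have hq : 0 ≤ weightTail lam 0 / weightTail lam 1 :=
    div_nonneg (h.weightTail_nonneg _) (h.weightTail_nonneg _)
  have hn0 := h.weightTail_nonneg n
  rcases Nat.lt_or_ge n 2 with hn | hn
  · rw [show n / 2 = 0 by omega]
    have h1 := h.weightTail_anti (show n ≤ 1 by omega)
    have : weightTail lam 0 ≤ weightTail lam 0 / weightTail lam 1 * weightTail lam n := by
      rw [div_mul_eq_mul_div, le_div_iff₀ (h.weightTail_pos 1)]
      exact mul_le_mul_of_nonneg_left h1 (h.weightTail_nonneg _)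
    nlinarith [mul_nonneg (sq_nonneg D) hn0]
  · set m := n / 2 with hm
    -- the block from `m` to `n` is controlled by the block from `n` to `2 n`
    have hm0 : (0 : ℝ) < m := Nat.cast_pos.2 (by omega)
    have hnR : (0 : ℝ) < n := Nat.cast_pos.2 (by omega)
    have h1 := h.weightTail_eq_sum_add m (n - m)
    rw [show m + (n - m) = n by omega] at h1
    have h2 := h.weightTail_eq_sum_add n n
    have h3 : ∑ j ∈ Finset.range (n - m), lam (j + m) / ((j + m : ℕ) : ℝ) ≤ 2 * lam m := by
      calc _ ≤ ∑ j ∈ Finset.range (n - m), lam m / m := by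
            refine Finset.sum_le_sum fun j _ => ?_
            refine div_le_div₀ (h.pos m).le (h.anti (by omega)) hm0 ?_
            exact_mod_cast (by omega : m ≤ j + m)
        _ = ((n - m : ℕ) : ℝ) * (lam m / m) := by simp
        _ ≤ (2 * m) * (lam m / m) := by
            refine mul_le_mul_of_nonneg_right ?_ (h.div_nonneg' m)
            exact_mod_cast (by omega : n - m ≤ 2 * m)
        _ = _ := by field_simp
    have h4 : lam (2 * n) / 2 ≤ ∑ j ∈ Finset.range n, lam (j + n) / ((j + n : ℕ) : ℝ) := by
      calc lam (2 * n) / 2 = n * (lam (2 * n) / (2 * n)) := by field_simp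
        _ = ∑ j ∈ Finset.range n, lam (2 * n) / (2 * n) := by simp
        _ ≤ _ := by
            refine Finset.sum_le_sum fun j hj => ?_
            have hj' := Finset.mem_range.1 hj
            refine div_le_div₀ (h.pos _).le (h.anti (by omega)) ?_ ?_
            · exact_mod_cast (by omega : 0 < j + n)
            · exact_mod_cast (by omega : j + n ≤ 2 * n)
    have h5 : lam m ≤ D ^ 2 * lam (2 * n) := by
      calc lam m ≤ D * lam n := hhalf n
        _ = D * lam (2 * n / 2) := by rw [show 2 * n / 2 = n by omega]
        _ ≤ D * (D * lam (2 * n)) := by gcongr; exact hhalf _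
        _ = _ := by ring
    have h6 := h.weightTail_nonneg (n + n)
    have h7 : lam (2 * n) ≤ 2 * weightTail lam n := by linarith
    have h8 : D ^ 2 * lam (2 * n) ≤ D ^ 2 * (2 * weightTail lam n) := by gcongr
    have h9 : 0 ≤ weightTail lam 0 / weightTail lam 1 * weightTail lam n := mul_nonneg hq hn0
    linarith

/-- Convolution with a sequence that is `O(lam n / n)` preserves the bound `O(weightTail n)`. -/
theorem convolution_le {lam : ℕ → ℝ} (h : IsDoublingWeight lam) {K : ℝ} (hK : 0 ≤ K) :
    ∃ C, 0 ≤ C ∧ ∀ {a x : ℕ → ℝ} {L : ℝ},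
    (∀ n, 0 ≤ a n) → (∀ n, 0 ≤ x n) → (∀ n, 1 ≤ n → a n ≤ K * (lam n / n)) → a 0 ≤ K →
    (∀ n, x n ≤ L * weightTail lam n) →
    ∀ n, ∑ p ∈ Finset.HasAntidiagonal.antidiagonal n, a p.1 * x p.2 ≤ C * L * weightTail lam n := by
  obtain ⟨D, hD, hhalf⟩ := h.weightTail_half
  have ht0 := h.weightTail_nonneg
  refine ⟨(K + K * weightTail lam 0 + weightTail lam 0 * K) * D, ?_, ?_⟩
  · have := ht0 0
    positivity
  intro a x L ha hx haK ha0 hxL n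
  have hL : 0 ≤ L := nonneg_of_mul_nonneg_left ((hx 0).trans (hxL 0)) (h.weightTail_pos 0)
  -- Index 0 needs its own bound since `lam 0 / 0 = 0`.
  set b : ℕ → ℝ := fun i => if i = 0 then K else K * (lam i / i) with hb
  have hab : ∀ i, a i ≤ b i := fun i => by
    simp only [hb]
    split_ifs with hi
    · rw [hi]; exact ha0
    · exact haK i (by omega)
  -- If `p.2 ≥ n / 2`, the tail bound on `x` is small and `a` is summable; otherwise `p.1 ≥ n / 2`
  -- and summing `lam i / i` over such indices produces the tail. Halving then costs only a
  -- constant.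
  have hterm : ∀ p ∈ Finset.HasAntidiagonal.antidiagonal n, a p.1 * x p.2 ≤
      L * weightTail lam (n / 2) * b p.1 +
        L * weightTail lam 0 * K * (if n / 2 ≤ p.1 then lam p.1 / p.1 else 0) := by
    intro p hp
    have hp' := Finset.HasAntidiagonal.mem_antidiagonal.1 hp
    have hb0 := (ha p.1).trans (hab p.1)
    have h1 : 0 ≤ L * weightTail lam (n / 2) * b p.1 :=
      mul_nonneg (mul_nonneg hL (ht0 _)) hb0
    have h2 : 0 ≤ L * weightTail lam 0 * K * (lam p.1 / p.1) :=
      mul_nonneg (mul_nonneg (mul_nonneg hL (ht0 _)) hK) (h.div_nonneg' _)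
    by_cases hpn : n / 2 ≤ p.2
    · have : a p.1 * x p.2 ≤ b p.1 * (L * weightTail lam (n / 2)) :=
        mul_le_mul (hab _) ((hxL _).trans (mul_le_mul_of_nonneg_left (h.weightTail_anti hpn) hL))
          (hx _) hb0
      split_ifs <;> linarith
    · have hp1 : n / 2 ≤ p.1 := by omega
      rw [if_pos hp1]
      have : a p.1 * x p.2 ≤ K * (lam p.1 / p.1) * (L * weightTail lam 0) :=
        mul_le_mul (haK _ (by omega))
          ((hxL _).trans (mul_le_mul_of_nonneg_left (h.weightTail_anti (Nat.zero_le _)) hL))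
          (hx _) (mul_nonneg hK (h.div_nonneg' _))
      linarith
  have hsum1 : ∑ i ∈ Finset.range n.succ, b i ≤ K + K * weightTail lam 0 := by
    have : ∀ i ∈ Finset.range n.succ, b i ≤ (if i = 0 then K else 0) + K * (lam i / i) := by
      intro i _
      simp only [hb]
      split_ifs with hi
      · simp [hi]
      · simp
    refine (Finset.sum_le_sum this).trans ?_
    rw [Finset.sum_add_distrib, ← Finset.mul_sum]
    gcongr
    · simp
    · simpa [weightTail] using h.summable.sum_le_tsum _ fun i _ => h.div_nonneg' i
  have hsum2 : ∑ i ∈ Finset.range n.succ, (if n / 2 ≤ i then lam i / (i : ℝ) else 0) ≤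
      weightTail lam (n / 2) := by
    rw [← Finset.sum_filter]
    have : (Finset.range n.succ).filter (fun i => n / 2 ≤ i) ⊆
        (Finset.range n.succ).image (fun i => i + n / 2) := by
      intro i hi
      simp only [Finset.mem_filter, Finset.mem_range] at hi
      exact Finset.mem_image.2 ⟨i - n / 2, by simp only [Finset.mem_range]; omega, by omega⟩
    refine (Finset.sum_le_sum_of_subset_of_nonneg this fun i _ _ => h.div_nonneg' i).trans ?_
    rw [Finset.sum_image (by intro x _ y _ hxy; simpa using hxy)]
    exact (h.summable_add (n / 2)).sum_le_tsum _ fun i _ => h.div_nonneg' _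
  refine (Finset.sum_le_sum hterm).trans ?_
  rw [Finset.sum_add_distrib, ← Finset.mul_sum, ← Finset.mul_sum,
    Finset.Nat.sum_antidiagonal_eq_sum_range_succ (fun i _ => b i),
    Finset.Nat.sum_antidiagonal_eq_sum_range_succ
      (fun i _ => if n / 2 ≤ i then lam i / (i : ℝ) else 0)]
  have e1 := mul_le_mul_of_nonneg_left hsum1 (mul_nonneg hL (ht0 (n / 2)))
  have e2 := mul_le_mul_of_nonneg_left hsum2 (mul_nonneg (mul_nonneg hL (ht0 0)) hK)
  have e3 := mul_le_mul_of_nonneg_left (hhalf n)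
    (show 0 ≤ (K + K * weightTail lam 0 + weightTail lam 0 * K) * L by have := ht0 0; positivity)
  linarith

end IsDoublingWeight

/-! ### From slowly varying functions to doubling weights -/

/-- The sequence `ℓ (max n 1)`. -/
noncomputable def seqWeight (ℓ : ℝ → ℝ) (n : ℕ) : ℝ := ℓ ((max n 1 : ℕ) : ℝ)

theorem seqWeight_of_pos (ℓ : ℝ → ℝ) {n : ℕ} (hn : 1 ≤ n) : seqWeight ℓ n = ℓ n := by
  rw [seqWeight, max_eq_left hn]

/-- A sequence with `lam n ≤ C lam (2n)` eventually, positive and decreasing, is doubling. -/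
theorem exists_half_le {lam : ℕ → ℝ} (hpos : ∀ n, 0 < lam n) (hanti : Antitone lam)
    (hev : ∀ᶠ n in atTop, lam n ≤ 2 * lam (4 * n)) :
    ∃ D, 0 < D ∧ ∀ n, lam (n / 2) ≤ D * lam n := by
  obtain ⟨n₀, hn₀⟩ := eventually_atTop.1 hev
  have hc : 0 ≤ lam 0 / lam (2 * (n₀ + 1)) := (div_pos (hpos _) (hpos _)).le
  refine ⟨2 + lam 0 / lam (2 * (n₀ + 1)), by positivity, fun n => ?_⟩
  by_cases hn : n₀ + 1 ≤ n / 2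
  · have h1 := hn₀ (n / 2) (by omega)
    -- The factor 4 leaves room for the rounding in `n / 2`.
    have h2 := hanti (show n ≤ 4 * (n / 2) by omega)
    nlinarith [mul_nonneg hc (hpos n).le]
  · have h1 : lam 0 ≤ lam 0 / lam (2 * (n₀ + 1)) * lam n := by
      rw [div_mul_eq_mul_div, le_div_iff₀ (hpos _)]
      exact mul_le_mul_of_nonneg_left (hanti (by omega)) (hpos 0).le
    have h2 := hanti (Nat.zero_le (n / 2))
    have := hpos n
    linarith

/-- Slow variation enters through the ratio `ℓ(4 x) / ℓ(x) → 1`, which is eventually at least `1 /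
2`. -/
theorem IsSlowlyVarying.isDoublingWeight {ℓ : ℝ → ℝ} (hsv : IsSlowlyVarying ℓ)
    (hanti : ∀ m n : ℕ, 1 ≤ m → m ≤ n → ℓ n ≤ ℓ m)
    (hlim : Tendsto (fun n : ℕ => ℓ n) atTop (𝓝 0)) (hs : Summable fun n : ℕ => ℓ n / n) :
    IsDoublingWeight (seqWeight ℓ) := by
  have hpos : ∀ n, 0 < seqWeight ℓ n := fun n => hsv.1 _ (by positivity)
  have hmono : Antitone (seqWeight ℓ) := fun m n hmn =>
    hanti _ _ (le_max_right _ _) (max_le_max hmn le_rfl)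
  have heq : ∀ᶠ n in atTop, ℓ ((n : ℕ) : ℝ) = seqWeight ℓ n := by
    filter_upwards [eventually_ge_atTop 1] with n hn using (seqWeight_of_pos ℓ hn).symm
  refine ⟨hpos, hmono, exists_half_le hpos hmono ?_, hlim.congr' heq, ?_⟩
  · have h1 := (hsv.2 4 (by norm_num)).comp tendsto_natCast_atTop_atTop
    filter_upwards [h1.eventually_const_le (show (1 / 2 : ℝ) < 1 by norm_num),
      eventually_ge_atTop 1] with n hn hn1
    have h2 := hpos n
    rw [seqWeight_of_pos ℓ hn1] at h2 ⊢
    rw [seqWeight_of_pos ℓ (by omega)]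
    simp only [Function.comp_apply] at hn
    rw [le_div_iff₀ h2] at hn
    push_cast
    linarith
  · refine hs.congr fun n => ?_
    rcases Nat.eq_zero_or_pos n with rfl | hn
    · simp
    · rw [seqWeight_of_pos ℓ hn]

/-- The tail sums over `Set.Ici n` as sums over `ℕ`. -/
theorem tsum_Ici_eq {f : ℕ → ℝ≥0∞} (n : ℕ) : ∑' j : Set.Ici n, f j = ∑' j : ℕ, f (j + n) := by
  let e : ℕ ≃ Set.Ici n :=
    { toFun := fun j => ⟨j + n, Nat.le_add_left n j⟩
      invFun := fun j => j - n
      left_inv := fun j => by simp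
      right_inv := fun j => Subtype.ext (Nat.sub_add_cancel j.2) }
  exact (e.tsum_eq fun j : Set.Ici n => f j).symm

theorem summable_of_tsum_Ici_ne_top {ℓ : ℝ → ℝ} (hsv : IsSlowlyVarying ℓ) {n : ℕ} (hn : 1 ≤ n)
    (h : ∑' j : Set.Ici n, ENNReal.ofReal (ℓ (j : ℕ) / (j : ℕ)) ≠ ∞) :
    Summable fun n : ℕ => ℓ n / n := by
  rw [tsum_Ici_eq (f := fun j => ENNReal.ofReal (ℓ j / j)) n] at h
  refine (summable_nat_add_iff n).1 ((ENNReal.summable_toReal h).congr fun j => ?_)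
  have hj : 0 < ((j + n : ℕ) : ℝ) := Nat.cast_pos.2 (by omega)
  exact ENNReal.toReal_ofReal (div_pos (hsv.1 _ hj) hj).le

theorem tsum_Ici_eq_weightTail {ℓ : ℝ → ℝ} (h : IsDoublingWeight (seqWeight ℓ)) {n : ℕ}
    (hn : 1 ≤ n) : ∑' j : Set.Ici n, ENNReal.ofReal (ℓ (j : ℕ) / (j : ℕ)) =
      ENNReal.ofReal (weightTail (seqWeight ℓ) n) := by
  rw [tsum_Ici_eq (f := fun j => ENNReal.ofReal (ℓ j / j)) n, weightTail,
    ENNReal.ofReal_tsum_of_nonneg (fun _ => h.div_nonneg' _) (h.summable_add n)]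
  refine tsum_congr fun j => ?_
  rw [seqWeight_of_pos ℓ (by omega)]

/-! ### The tower: invariance, column sums, tails of the return time -/

namespace InducingScheme

variable {X : Type*} [MeasurableSpace X] (S : InducingScheme X)

theorem measurable_F : Measurable S.F := S.measurePreserving_F.measurable

theorem measurable_iterate (n : ℕ) : Measurable S.T^[n] := S.measurable_T.iterate n

theorem measurable_iterate_coe (n : ℕ) : Measurable fun y : S.Y => S.T^[n] (y : X) :=
  (S.measurable_iterate n).comp measurable_subtype_coe

theorem measurable_proj : Measurable fun p : S.Y × ℕ => S.T^[p.2] (p.1 : X) :=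
  measurable_from_prod_countable_left fun n => S.measurable_iterate_coe n

theorem measurableSet_tower : MeasurableSet S.tower :=
  measurableSet_lt measurable_snd (S.measurable_φ.comp measurable_fst)

/-- The sum of `h` over the column of the tower above `y`. -/
def columnSum {E : Type*} [AddCommMonoid E] (h : X → E) (y : S.Y) : E :=
  ∑ l ∈ Finset.range (S.φ y), h (S.T^[l] (y : X))

theorem lintegral_φ_ne_zero : ∫⁻ y, (S.φ y : ℝ≥0∞) ∂S.μ ≠ 0 := by
  have : (1 : ℝ≥0∞) ≤ ∫⁻ y, (S.φ y : ℝ≥0∞) ∂S.μ := by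
    calc (1 : ℝ≥0∞) = ∫⁻ _, 1 ∂S.μ := by simp
      _ ≤ _ := lintegral_mono fun y => Nat.one_le_cast.2 (S.φ_pos y)
  exact (zero_lt_one.trans_le this).ne'

theorem lintegral_φ_eq : ∫⁻ y, (S.φ y : ℝ≥0∞) ∂S.μ = ENNReal.ofReal (∫ y, (S.φ y : ℝ) ∂S.μ) := by
  rw [ofReal_integral_eq_lintegral_ofReal S.integrable_φ (ae_of_all _ fun y => Nat.cast_nonneg _)]
  simp

theorem lintegral_φ_ne_top : ∫⁻ y, (S.φ y : ℝ≥0∞) ∂S.μ ≠ ∞ := by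
  rw [lintegral_φ_eq]; exact ENNReal.ofReal_ne_top

/-- The mean return time. -/
noncomputable def meanTime : ℝ := ∫ y, (S.φ y : ℝ) ∂S.μ

theorem one_le_meanTime : 1 ≤ S.meanTime := by
  have : ∫ _, (1 : ℝ) ∂S.μ ≤ S.meanTime :=
    integral_mono (integrable_const _) S.integrable_φ fun y => Nat.one_le_cast.2 (S.φ_pos y)
  simpa using this

theorem lintegral_μX {f : X → ℝ≥0∞} (hf : Measurable f) :
    ∫⁻ x, f x ∂S.μX = (∫⁻ y, (S.φ y : ℝ≥0∞) ∂S.μ)⁻¹ * ∫⁻ y, S.columnSum f y ∂S.μ := by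
  have hfm : Measurable fun p : S.Y × ℕ => f (S.T^[p.2] (p.1 : X)) := hf.comp S.measurable_proj
  rw [μX, lintegral_map hf S.measurable_proj, towerMeasure, lintegral_smul_measure, smul_eq_mul,
    ← lintegral_indicator S.measurableSet_tower, lintegral_prod _
      (hfm.indicator S.measurableSet_tower).aemeasurable]
  congr 1
  refine lintegral_congr fun y => ?_
  rw [lintegral_count, columnSum, tsum_eq_sum (s := Finset.range (S.φ y))]
  · refine Finset.sum_congr rfl fun l hl => ?_
    rw [Set.indicator_of_mem]
    exact Finset.mem_range.1 hl
  · intro l hl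
    rw [Set.indicator_of_notMem]
    exact fun h => hl (Finset.mem_range.2 h)

/-- Shifting the orbit segment `y, …, T^{φ y - 1} y` by one step drops `y` and gains `F y`.
Integrated against the `F`-invariant `μ`, this yields the invariance of `μX` under `T`. -/
theorem columnSum_comp_T {E : Type*} [AddCommMonoid E] (h : X → E) (y : S.Y) :
    S.columnSum (fun x => h (S.T x)) y + h y = S.columnSum h y + h (S.F y) := by
  simp only [columnSum, ← Function.iterate_succ_apply' S.T]
  rw [F, ← Finset.sum_range_succ (fun l => h (S.T^[l] (y : X))),
    Finset.sum_range_succ' (fun l => h (S.T^[l] (y : X)))]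
  rfl

instance : IsProbabilityMeasure S.μX := by
  refine ⟨?_⟩
  rw [← lintegral_one, S.lintegral_μX measurable_const]
  simp only [columnSum, Finset.sum_const, Finset.card_range, nsmul_eq_mul, mul_one]
  exact ENNReal.inv_mul_cancel S.lintegral_φ_ne_zero S.lintegral_φ_ne_top

theorem measurePreserving_T : MeasurePreserving S.T S.μX S.μX := by
  refine ⟨S.measurable_T, Measure.ext fun s hs => ?_⟩
  rw [Measure.map_apply S.measurable_T hs, ← lintegral_indicator_one (S.measurable_T hs),
    ← lintegral_indicator_one hs]
  set f : X → ℝ≥0∞ := s.indicator 1 with hf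
  have hfm : Measurable f := measurable_one.indicator hs
  change ∫⁻ x, f (S.T x) ∂S.μX = _
  have hfT : Measurable fun x => f (S.T x) := hfm.comp S.measurable_T
  rw [S.lintegral_μX hfm, S.lintegral_μX hfT]
  congr 1
  -- Finiteness permits cancelling the two boundary integrals in `ℝ≥0∞`.
  have hfin : ∫⁻ y : S.Y, f y ∂S.μ ≠ ∞ := by
    refine ne_top_of_le_ne_top (b := 1) ENNReal.one_ne_top ?_
    calc ∫⁻ y : S.Y, f y ∂S.μ ≤ ∫⁻ _, 1 ∂S.μ :=
          lintegral_mono fun y => Set.indicator_le_self' (fun _ _ => zero_le_one) _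
      _ = 1 := by simp
  have h1 := lintegral_congr (μ := S.μ) (S.columnSum_comp_T f)
  have hfc : Measurable fun y : S.Y => f y := hfm.comp measurable_subtype_coe
  have hfF : Measurable fun y : S.Y => f (S.F y) := hfc.comp S.measurable_F
  rw [lintegral_add_right _ hfc, lintegral_add_right _ hfF,
    S.measurePreserving_F.lintegral_comp hfc] at h1
  exact (ENNReal.add_left_inj hfin).1 h1

/-- Integrals over `X` as integrals of column sums. -/
theorem integral_μX {h : X → ℂ} (hh : Integrable h S.μX) :
    Integrable (S.columnSum h) S.μ ∧
      ∫ y, S.columnSum h y ∂S.μ = S.meanTime * ∫ x, h x ∂S.μX := by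
  have h1 : Integrable (fun p : S.Y × ℕ => h (S.T^[p.2] (p.1 : X))) S.towerMeasure :=
    hh.comp_measurable S.measurable_proj
  have e1 : ∫ x, h x ∂S.μX = ∫ p : S.Y × ℕ, h (S.T^[p.2] (p.1 : X)) ∂S.towerMeasure :=
    integral_map S.measurable_proj.aemeasurable hh.aestronglyMeasurable
  have hc0 : (∫⁻ y, (S.φ y : ℝ≥0∞) ∂S.μ)⁻¹ ≠ 0 := ENNReal.inv_ne_zero.2 S.lintegral_φ_ne_top
  have hct : (∫⁻ y, (S.φ y : ℝ≥0∞) ∂S.μ)⁻¹ ≠ ∞ := ENNReal.inv_ne_top.2 S.lintegral_φ_ne_zero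
  rw [towerMeasure, integrable_smul_measure hc0 hct, ← IntegrableOn,
    ← integrable_indicator_iff S.measurableSet_tower] at h1
  have e2 : ∀ y, ∫ l, S.tower.indicator (fun p : S.Y × ℕ => h (S.T^[p.2] (p.1 : X))) (y, l)
      ∂Measure.count = S.columnSum h y := by
    intro y
    have hsupp : ∀ l ∉ Finset.range (S.φ y),
        S.tower.indicator (fun p : S.Y × ℕ => h (S.T^[p.2] (p.1 : X))) (y, l) = 0 := by
      intro l hl
      rw [Set.indicator_of_notMem]
      exact fun h => hl (Finset.mem_range.2 h)
    rw [integral_countable, columnSum, tsum_eq_sum (s := Finset.range (S.φ y))]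
    · refine Finset.sum_congr rfl fun l hl => ?_
      rw [Set.indicator_of_mem (show (y, l) ∈ S.tower from Finset.mem_range.1 hl)]
      simp [measureReal_def]
    · intro l hl
      rw [hsupp l hl, smul_zero]
    · rw [integrable_count_iff]
      exact summable_of_ne_finset_zero (s := Finset.range (S.φ y)) fun l hl => by
        simp only [hsupp l hl, norm_zero]
  have h2 := h1.integral_prod_left
  simp only [e2] at h2
  refine ⟨h2, ?_⟩
  rw [e1, towerMeasure, integral_smul_measure, ← integral_indicator S.measurableSet_tower,
    integral_prod _ h1]
  simp only [e2]
  rw [ENNReal.toReal_inv, lintegral_φ_eq, ENNReal.toReal_ofReal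
    (by have := S.one_le_meanTime; rw [meanTime] at this; linarith), ← meanTime,
    Complex.real_smul, Complex.ofReal_inv, mul_inv_cancel_left₀]
  have := S.one_le_meanTime
  exact_mod_cast (by linarith : S.meanTime ≠ 0)

/-- The truncated mean `∫ (φ - n)⁺`. -/
noncomputable def tailMean (n : ℕ) : ℝ := ∫ y, ((S.φ y - n : ℕ) : ℝ) ∂S.μ

theorem integrable_φ_sub (n : ℕ) : Integrable (fun y => ((S.φ y - n : ℕ) : ℝ)) S.μ := by
  refine S.integrable_φ.mono' ?_ (ae_of_all _ fun y => ?_)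
  · exact ((measurable_from_nat (f := fun k : ℕ => ((k - n : ℕ) : ℝ))).comp
      S.measurable_φ).aestronglyMeasurable
  · rw [Real.norm_of_nonneg (Nat.cast_nonneg _)]
    exact_mod_cast Nat.sub_le _ _

theorem measurableSet_lt_φ (n : ℕ) : MeasurableSet {y | n < S.φ y} :=
  S.measurable_φ (measurableSet_Ioi (a := n))

theorem measurableSet_le_φ (n : ℕ) : MeasurableSet {y | n ≤ S.φ y} :=
  S.measurable_φ (measurableSet_Ici (a := n))

theorem tailMean_succ (n : ℕ) : S.tailMean n = S.μ.real {y | n < S.φ y} + S.tailMean (n + 1) := by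
  have : S.μ.real {y | n < S.φ y} = ∫ y, {y | n < S.φ y}.indicator (fun _ => (1 : ℝ)) y ∂S.μ := by
    rw [integral_indicator_const _ (S.measurableSet_lt_φ n)]; simp
  rw [this, tailMean, tailMean, ← integral_add _ (S.integrable_φ_sub _)]
  · refine integral_congr_ae (ae_of_all _ fun y => ?_)
    by_cases hy : n < S.φ y
    · simp only [Set.indicator_of_mem (show y ∈ {y | n < S.φ y} from hy)]
      rw [show S.φ y - n = 1 + (S.φ y - (n + 1)) by omega]
      push_cast; ring
    · simp only [Set.indicator_of_notMem (show y ∉ {y | n < S.φ y} from hy)]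
      rw [show S.φ y - n = 0 by omega, show S.φ y - (n + 1) = 0 by omega]
      simp
  · exact (integrable_const _).indicator (S.measurableSet_lt_φ n)

theorem tailMean_eq_sum_add (n k : ℕ) : S.tailMean n =
    ∑ j ∈ Finset.range k, S.μ.real {y | j + n < S.φ y} + S.tailMean (n + k) := by
  induction k with
  | zero => simp
  | succ k ih =>
    rw [ih, S.tailMean_succ (n + k), Finset.sum_range_succ, add_comm k n, add_assoc, add_assoc]

theorem tendsto_tailMean : Tendsto S.tailMean atTop (𝓝 0) := by
  have : Tendsto S.tailMean atTop (𝓝 (∫ _, (0 : ℝ) ∂S.μ)) := by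
    refine tendsto_integral_of_dominated_convergence (fun y => (S.φ y : ℝ))
      (fun n => (S.integrable_φ_sub n).aestronglyMeasurable) S.integrable_φ
      (fun n => ae_of_all _ fun y => ?_) (ae_of_all _ fun y => ?_)
    · rw [Real.norm_of_nonneg (Nat.cast_nonneg _)]
      exact_mod_cast Nat.sub_le _ _
    · refine tendsto_const_nhds.congr' ?_
      filter_upwards [eventually_ge_atTop (S.φ y)] with n hn
      rw [Nat.sub_eq_zero_of_le hn, Nat.cast_zero]
  simpa using this

/-- `∫ (φ - n)⁺` telescopes into `∑_{j ≥ n} μ(φ > j)`, the remainder tending to zero by dominated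
convergence. This is one source of the tail sum in the final rate. -/
theorem tailMean_le {lam : ℕ → ℝ} (h : IsDoublingWeight lam) {C : ℝ}
    (hC : ∀ n, 1 ≤ n → S.μ.real {y | n < S.φ y} ≤ C * (lam n / n)) {n : ℕ} (hn : 1 ≤ n) :
    S.tailMean n ≤ C * weightTail lam n := by
  have hC0 : 0 ≤ C := nonneg_of_mul_nonneg_left (measureReal_nonneg.trans (hC 1 le_rfl))
    (div_pos (h.pos 1) (by norm_num))
  have hlim : Tendsto (fun k => C * weightTail lam n + S.tailMean (n + k)) atTop
      (𝓝 (C * weightTail lam n + 0)) :=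
    tendsto_const_nhds.add (S.tendsto_tailMean.comp (tendsto_add_atTop_nat n |>.congr fun k =>
      add_comm k n))
  rw [add_zero] at hlim
  refine ge_of_tendsto' hlim fun k => ?_
  rw [S.tailMean_eq_sum_add n k]
  gcongr
  calc ∑ j ∈ Finset.range k, S.μ.real {y | j + n < S.φ y}
      ≤ ∑ j ∈ Finset.range k, C * (lam (j + n) / ((j + n : ℕ) : ℝ)) :=
        Finset.sum_le_sum fun j _ => hC _ (by omega)
    _ = C * ∑ j ∈ Finset.range k, lam (j + n) / ((j + n : ℕ) : ℝ) := by rw [Finset.mul_sum]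
    _ ≤ _ := by
        gcongr
        exact (h.summable_add n).sum_le_tsum _ fun j _ => h.div_nonneg' _

/-- The derived observable that looks at `v` at time `j` before the return. -/
def before (v : X → ℝ) (j : ℕ) (y : S.Y) : ℝ :=
  if j ≤ S.φ y then v (S.T^[S.φ y - j] (y : X)) else v y

/-- A derived observable must pick a time on every level of `φ`. On the levels `φ < j` the fallback
picks time 0; those levels are later cut off by the indicator of `{j ≤ φ}`. -/
theorem before_mem_derived (v : X → ℝ) {j : ℕ} (hj : 1 ≤ j) : S.before v j ∈ S.derived v := by
  intro n hn
  by_cases h : j ≤ n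
  · exact ⟨n - j, by omega, fun y hy => by rw [before, hy, if_pos h]⟩
  · exact ⟨0, by omega, fun y hy => by rw [before, hy, if_neg h]; rfl⟩

/-- Splitting a correlation according to the time of the first return to the base. -/
theorem columnSum_mul_eq (v : X → ℝ) (ω : X → ℂ) (n : ℕ) (y : S.Y) :
    S.columnSum (fun x => (v x : ℂ) * ω (S.T^[n] x)) y =
      ∑ l ∈ Finset.range (S.φ y - n), (v (S.T^[l] (y : X)) : ℂ) * ω (S.T^[l + n] (y : X)) +
      ∑ j ∈ Finset.range n, {y | j + 1 ≤ S.φ y}.indicator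
        (fun y => (S.before v (j + 1) y : ℂ) * ω (S.T^[n - (j + 1)] (S.F y : X))) y := by
  set G : ℕ → ℂ := fun l => (v (S.T^[l] (y : X)) : ℂ) * ω (S.T^[l + n] (y : X)) with hG
  have e1 : S.columnSum (fun x => (v x : ℂ) * ω (S.T^[n] x)) y =
      ∑ l ∈ Finset.range (S.φ y), G l := by
    refine Finset.sum_congr rfl fun l _ => ?_
    simp only [hG]
    rw [add_comm l n, Function.iterate_add_apply]
  -- Substitute `l = φ y - (j + 1)`: after `j + 1` steps the orbit is at `F y`, with `n - (j + 1)`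
  -- iterates left.
  have e2 : ∑ j ∈ Finset.range n, {y | j + 1 ≤ S.φ y}.indicator
        (fun y => (S.before v (j + 1) y : ℂ) * ω (S.T^[n - (j + 1)] (S.F y : X))) y =
      ∑ j ∈ Finset.range (min n (S.φ y)), G (S.φ y - 1 - j) := by
    have hsub : Finset.range (min n (S.φ y)) ⊆ Finset.range n :=
      Finset.range_mono (min_le_left _ _)
    rw [← Finset.sum_subset hsub]
    · refine Finset.sum_congr rfl fun j hj => ?_
      have hj' := Finset.mem_range.1 hj
      have hj1 : j + 1 ≤ S.φ y := by omega
      rw [Set.indicator_of_mem (show y ∈ {y | j + 1 ≤ S.φ y} from hj1), before, if_pos hj1]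
      simp only [hG, F, ← Function.iterate_add_apply]
      rw [show S.φ y - (j + 1) = S.φ y - 1 - j by omega,
        show n - (j + 1) + S.φ y = S.φ y - 1 - j + n by omega]
    · intro j hj hj'
      simp only [Finset.mem_range] at hj hj'
      rw [Set.indicator_of_notMem]
      exact fun hy : j + 1 ≤ S.φ y => hj' (by omega)
  rw [e1, e2]
  have e3 : ∑ j ∈ Finset.range (min n (S.φ y)), G (S.φ y - 1 - j) =
      ∑ j ∈ Finset.range (min n (S.φ y)), G (S.φ y - n + j) := by
    rw [← Finset.sum_range_reflect]
    refine Finset.sum_congr rfl fun j hj => ?_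
    have hj' := Finset.mem_range.1 hj
    congr 1
    omega
  rw [e3, ← Finset.sum_range_add]
  congr 2
  omega

end InducingScheme

/-! ### Functionals on `B` given by integration -/

section Pairing

variable {α : Type*} [MeasurableSpace α] {μ : Measure α}

theorem integrable_Lp_mul (g : Lp ℂ 1 μ) {w : α → ℂ} (hw : Measurable w) {K : ℝ}
    (hK : ∀ y, ‖w y‖ ≤ K) : Integrable (fun y => g y * w y) μ :=
  (L1.integrable_coeFn g).mul_bdd (c := K) hw.aestronglyMeasurable (ae_of_all _ hK)

/-- Integration against a bounded measurable function, as a functional on `L¹`. -/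
noncomputable def testFunctional {w : α → ℂ} (hw : Measurable w) {K : ℝ} (hK : ∀ y, ‖w y‖ ≤ K) :
    Lp ℂ 1 μ →L[ℂ] ℂ :=
  LinearMap.mkContinuous
    { toFun := fun g => ∫ y, g y * w y ∂μ
      map_add' := fun g g' => by
        rw [← integral_add (integrable_Lp_mul g hw hK) (integrable_Lp_mul g' hw hK)]
        refine integral_congr_ae ?_
        filter_upwards [Lp.coeFn_add g g'] with y hy
        rw [hy, Pi.add_apply, add_mul]
      map_smul' := fun c g => by
        rw [RingHom.id_apply, smul_eq_mul, ← integral_const_mul]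
        refine integral_congr_ae ?_
        filter_upwards [Lp.coeFn_smul c g] with y hy
        rw [hy, Pi.smul_apply, smul_eq_mul, mul_assoc] } K fun g => by
    rw [L1.norm_eq_integral_norm, ← integral_const_mul]
    refine norm_integral_le_of_norm_le ((L1.integrable_coeFn g).norm.const_mul K)
      (ae_of_all _ fun y => ?_)
    rw [norm_mul, mul_comm]
    exact mul_le_mul_of_nonneg_right (hK y) (norm_nonneg _)

variable {B : Type*} [NormedAddCommGroup B] [NormedSpace ℂ B] [CompleteSpace B]

namespace BanachFunctionSpace

variable (E : BanachFunctionSpace μ B)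

/-- Integration against a bounded measurable function, as a functional on `B`. -/
noncomputable def pairing {w : α → ℂ} (hw : Measurable w) {K : ℝ} (hK : ∀ y, ‖w y‖ ≤ K) :
    B →L[ℂ] ℂ :=
  (testFunctional hw hK).comp
    (E.toL1.mkContinuous 1 fun b => by rw [one_mul]; exact E.norm_toL1_le b)

theorem pairing_apply {w : α → ℂ} (hw : Measurable w) {K : ℝ} (hK : ∀ y, ‖w y‖ ≤ K) (b : B) :
    E.pairing hw hK b = ∫ y, E.toL1 b y * w y ∂μ := rfl

/-- The embedding in `L^∞` converts the support of the test function into a factor `μ(s)`; the bound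
`|b|₁ ≤ ‖b‖` alone would give no decay for functionals living on `{φ > n}`. -/
theorem norm_pairing_le [IsFiniteMeasure μ] {K₀ : ℝ} (hE : ∀ b, ∀ᵐ y ∂μ, ‖E.toL1 b y‖ ≤ K₀ * ‖b‖)
    (hK₀ : 0 ≤ K₀) {w : α → ℂ} (hw : Measurable w) {K : ℝ} (hK0 : 0 ≤ K) (hK : ∀ y, ‖w y‖ ≤ K)
    {s : Set α} (hs : MeasurableSet s) (hws : ∀ y ∉ s, w y = 0) :
    ‖E.pairing hw hK‖ ≤ K₀ * K * μ.real s := by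
  refine ContinuousLinearMap.opNorm_le_bound _ (by positivity) fun b => ?_
  have h1 : ‖E.pairing hw hK b‖ ≤ ∫ y, s.indicator (fun _ => K₀ * ‖b‖ * K) y ∂μ := by
    refine norm_integral_le_of_norm_le ((integrable_const _).indicator hs) ?_
    filter_upwards [hE b] with y hy
    by_cases hys : y ∈ s
    · rw [Set.indicator_of_mem hys, norm_mul]
      exact mul_le_mul hy (hK y) (norm_nonneg _) (by positivity)
    · rw [Set.indicator_of_notMem hys, hws y hys]; simp
  rw [integral_indicator_const _ hs, smul_eq_mul] at h1
  linarith

/-- The element of `B` that represents the constant function `1`. -/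
noncomputable def unit : B := (E.const_mem 1).choose

theorem toL1_unit : E.toL1 E.unit =ᵐ[μ] fun _ => 1 := (E.const_mem 1).choose_spec

/-- The total integral as a functional on `B`. -/
noncomputable def mass : B →L[ℂ] ℂ :=
  E.pairing (w := fun _ => 1) measurable_const (K := 1) fun _ => by simp

theorem mass_apply (b : B) : E.mass b = ∫ y, E.toL1 b y ∂μ := by
  rw [mass, pairing_apply]; simp

theorem mass_unit [IsProbabilityMeasure μ] : E.mass E.unit = 1 := by
  rw [mass_apply, integral_congr_ae E.toL1_unit]; simp

end BanachFunctionSpace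

end Pairing

/-! ### The regularised renewal operator and its invertibility -/

/-- A rank one modification of `1 - A`, for an operator `A` with simple eigenvalue `1`, that is
invertible. -/
theorem IsSimpleIsolatedEigenvalue.isUnit_modification {B : Type*} [NormedAddCommGroup B]
    [NormedSpace ℂ B] [CompleteSpace B] {A : B →L[ℂ] B} (hA : IsSimpleIsolatedEigenvalue A 1)
    {e : B} {p q : B →L[ℂ] ℂ} (hpe : p e = 1) (hAe : A e = e) (hpA : ∀ b, p (A b) = p b)
    (hqe : q e ≠ 0) :
    IsUnit (q.smulRight e + (1 - p.smulRight e) * (1 - A)) := by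
  obtain ⟨hfin, hcompl, -⟩ := hA
  have he0 : e ≠ 0 := by
    rintro rfl
    simp at hpe
  -- The range of `1 - A` is killed by `p`, so the projection `1 - p ⊗ e` acts trivially on it.
  have happ : ∀ u, (q.smulRight e + (1 - p.smulRight e) * (1 - A)) u = q u • e + (u - A u) := by
    intro u
    change q u • e + ((u - A u) - p (u - A u) • e) = _
    rw [map_sub, hpA, sub_self, zero_smul, sub_zero]
  have hmem : ∀ u, u ∈ LinearMap.ker ((A - (1 : ℂ) • ContinuousLinearMap.id ℂ B : B →L[ℂ] B) :
      B →ₗ[ℂ] B) ↔ A u = u := by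
    intro u
    rw [LinearMap.mem_ker]
    change A u - (1 : ℂ) • u = 0 ↔ _
    rw [one_smul, sub_eq_zero]
  have hker : ∀ u, A u = u → ∃ c : ℂ, u = c • e := by
    intro u hu
    have he : (⟨e, (hmem e).2 hAe⟩ : LinearMap.ker ((A - (1 : ℂ) • ContinuousLinearMap.id ℂ B :
      B →L[ℂ] B) : B →ₗ[ℂ] B)) ≠ 0 := fun h => he0 (congrArg Subtype.val h)
    obtain ⟨c, hc⟩ := (finrank_eq_one_iff_of_nonzero' _ he).1 hfin ⟨u, (hmem u).2 hu⟩
    exact ⟨c, (congrArg Subtype.val hc).symm⟩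
  rw [ContinuousLinearMap.isUnit_iff_bijective]
  constructor
  -- Applying `p` gives `q u = 0`, hence `A u = u` and `u = c • e`; then `q e ≠ 0` forces `c = 0`.
  · refine (injective_iff_map_eq_zero _).2 fun u hu => ?_
    rw [happ] at hu
    have h1 := congrArg p hu
    rw [map_add, map_smul, map_sub, hpA, hpe, sub_self, add_zero, map_zero, smul_eq_mul,
      mul_one] at h1
    rw [h1, zero_smul, zero_add, sub_eq_zero] at hu
    obtain ⟨c, rfl⟩ := hker u hu.symm
    rw [map_smul, smul_eq_mul, mul_eq_zero, or_iff_left hqe] at h1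
    rw [h1, zero_smul]
  · intro x
    have hx : x ∈ LinearMap.ker ((A - (1 : ℂ) • ContinuousLinearMap.id ℂ B : B →L[ℂ] B) :
        B →ₗ[ℂ] B) ⊔ LinearMap.range ((A - (1 : ℂ) • ContinuousLinearMap.id ℂ B : B →L[ℂ] B) :
        B →ₗ[ℂ] B) := by rw [hcompl.sup_eq_top]; trivial
    obtain ⟨k, hk, r, ⟨u, hu⟩, rfl⟩ := Submodule.mem_sup.1 hx
    obtain ⟨c, rfl⟩ := hker k ((hmem k).1 hk)
    have hu' : A u - u = r := by
      rw [← hu]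
      change _ = A u - (1 : ℂ) • u
      rw [one_smul]
    -- With `x = c • e + (A u - u)`, the vector `-u` produces `A u - u`; the multiple of `e`, fixed
    -- by `A`, is chosen so that `q` takes the value `c`.
    refine ⟨-u + ((c + q u) / q e) • e, ?_⟩
    rw [happ]
    simp only [map_add, map_neg, map_smul, hAe, smul_eq_mul, div_mul_cancel₀ _ hqe, ← hu']
    rw [show -q u + (c + q u) = c by ring]
    abel

/-- Scaling the range of a projection by a nonzero factor is invertible. -/
theorem isUnit_smul_add_one_sub {A : Type*} [Ring A] [Algebra ℂ A] {P : A} (hP : P * P = P) {c : ℂ}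
    (hc : c ≠ 0) : IsUnit (c • P + (1 - P)) := by
  have key : ∀ a b : ℂ, a * b = 1 → (a • P + (1 - P)) * (b • P + (1 - P)) = 1 := by
    intro a b hab
    simp only [mul_add, add_mul, mul_sub, sub_mul, smul_mul_assoc, mul_smul_comm, hP, mul_one,
      one_mul, sub_self, add_zero]
    rw [smul_smul, mul_comm b a, hab, one_smul]
    abel
  exact ⟨⟨_, c⁻¹ • P + (1 - P), key _ _ (mul_inv_cancel₀ hc), key _ _ (inv_mul_cancel₀ hc)⟩, rfl⟩

namespace InducingScheme

variable {X : Type*} [MeasurableSpace X] (S : InducingScheme X)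
  {B : Type*} [NormedAddCommGroup B] [NormedSpace ℂ B] [CompleteSpace B]
  {E : BanachFunctionSpace S.μ B}

/-- The operators `Rn` on `B` are restrictions of the operators `R 1_{φ = n}`. -/
def IsRenewalFamily (E : BanachFunctionSpace S.μ B) (Rn : ℕ → B →L[ℂ] B) : Prop :=
  ∀ n b, E.toL1 (Rn n b) = S.renewalOp n (E.toL1 b)

theorem integral_renewalOp_mul (n : ℕ) (u : Lp ℂ 1 S.μ) {w : S.Y → ℂ} (hw : Measurable w)
    (hK : ∃ K : ℝ, ∀ y, ‖w y‖ ≤ K) :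
    ∫ y, S.renewalOp n u y * w y ∂S.μ =
      ∫ y, {y | S.φ y = n}.indicator (fun y => u y * w (S.F y)) y ∂S.μ := by
  rw [renewalOp, isTransfer_transferOp S.μ S.F S.measurePreserving_F _ w hw hK]
  refine integral_congr_ae ?_
  have : mulIndicatorL1 S.μ (S.measurableSet_level n) u =ᵐ[S.μ] {y | S.φ y = n}.indicator u :=
    MemLp.coeFn_toLp _
  filter_upwards [this] with y hy
  rw [hy]
  by_cases h : y ∈ {y | S.φ y = n} <;> simp [h]

theorem integrable_mul_comp_F (u : Lp ℂ 1 S.μ) {w : S.Y → ℂ} (hw : Measurable w)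
    (hK : ∃ K : ℝ, ∀ y, ‖w y‖ ≤ K) : Integrable (fun y => u y * w (S.F y)) S.μ := by
  obtain ⟨K, hK⟩ := hK
  exact integrable_Lp_mul u (hw.comp S.measurable_F) fun y => hK (S.F y)

theorem renewalOp_zero (u : Lp ℂ 1 S.μ) : S.renewalOp 0 u = 0 := by
  refine (isTransfer_transferOp S.μ S.F S.measurePreserving_F _).unique fun w hw hK => ?_
  rw [← isTransfer_transferOp S.μ S.F S.measurePreserving_F _ w hw hK]
  have h1 := S.integral_renewalOp_mul 0 u hw hK
  rw [renewalOp] at h1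
  rw [h1]
  have h2 : {y | S.φ y = 0} = ∅ := Set.eq_empty_of_forall_notMem fun y (hy : S.φ y = 0) => by
    have := S.φ_pos y; omega
  rw [h2, integral_congr_ae (g := fun _ => 0)]
  · simp
  · filter_upwards [Lp.coeFn_zero ℂ 1 S.μ] with y hy
    rw [hy]; simp

variable {S} in
theorem IsRenewalFamily.zero {Rn : ℕ → B →L[ℂ] B} (hR : S.IsRenewalFamily E Rn) : Rn 0 = 0 :=
  ContinuousLinearMap.ext fun b => E.injective (by
    rw [hR, renewalOp_zero]; simp)

variable {S} in
/-- Duality for the tails `∑_{m ≥ j} R_m`. -/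
theorem IsRenewalFamily.integral_tail_mul {Rn : ℕ → B →L[ℂ] B} (hR : S.IsRenewalFamily E Rn)
    (hs : Summable fun n => ‖Rn n‖) (j : ℕ) (b : B) {w : S.Y → ℂ} (hw : Measurable w) {K : ℝ}
    (hK : ∀ y, ‖w y‖ ≤ K) :
    E.pairing hw hK ((∑' m, Rn (m + j)) b) =
      ∫ y, {y | j ≤ S.φ y}.indicator (fun y => E.toL1 b y * w (S.F y)) y ∂S.μ := by
  have hs' : Summable fun m => Rn (m + j) := ((summable_nat_add_iff j).2 hs).of_norm
  have h1 : HasSum (fun m => E.pairing hw hK (Rn (m + j) b))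
      (E.pairing hw hK ((∑' m, Rn (m + j)) b)) :=
    (E.pairing hw hK).hasSum ((ContinuousLinearMap.apply ℂ B b).hasSum hs'.hasSum)
  have h2 : HasSum (fun m => ∫ y in {y | S.φ y = m + j}, E.toL1 b y * w (S.F y) ∂S.μ)
      (∫ y in ⋃ m, {y | S.φ y = m + j}, E.toL1 b y * w (S.F y) ∂S.μ) := by
    refine hasSum_integral_iUnion (fun m => S.measurableSet_level _) ?_
      (S.integrable_mul_comp_F _ hw ⟨K, hK⟩).integrableOn
    intro m m' hmm
    refine Set.disjoint_left.2 fun y (hy : S.φ y = m + j) (hy' : S.φ y = m' + j) => hmm ?_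
    omega
  have h3 : ⋃ m, {y | S.φ y = m + j} = {y | j ≤ S.φ y} := by
    ext y
    simp only [Set.mem_iUnion, Set.mem_ofPred_eq]
    exact ⟨fun ⟨m, hm⟩ => by omega, fun h => ⟨S.φ y - j, by omega⟩⟩
  rw [h3] at h2
  rw [integral_indicator (S.measurableSet_le_φ j)]
  refine h1.unique (h2.congr_fun fun m => ?_)
  rw [E.pairing_apply, hR, S.integral_renewalOp_mul _ _ hw ⟨K, hK⟩,
    integral_indicator (S.measurableSet_level _)]

/-- The functional `b ↦ ∫_{φ > n} b dμ`. -/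
noncomputable def tailMass (E : BanachFunctionSpace S.μ B) (n : ℕ) : B →L[ℂ] ℂ :=
  E.pairing (w := {y | n < S.φ y}.indicator fun _ => 1)
    (measurable_const.indicator (S.measurableSet_lt_φ n)) (K := 1) fun y => by
      by_cases h : y ∈ {y | n < S.φ y} <;> simp [h]

theorem tailMass_apply (n : ℕ) (b : B) :
    S.tailMass E n b = ∫ y, {y | n < S.φ y}.indicator (E.toL1 b) y ∂S.μ := by
  rw [tailMass, E.pairing_apply]
  refine integral_congr_ae (ae_of_all _ fun y => ?_)
  by_cases h : y ∈ {y | n < S.φ y} <;> simp [h]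

theorem tailMass_zero : S.tailMass E 0 = E.mass := by
  ext b
  rw [tailMass_apply, E.mass_apply]
  congr 1
  ext y
  exact Set.indicator_of_mem (show y ∈ {y | 0 < S.φ y} from S.φ_pos y) _

theorem tailMass_unit (n : ℕ) : S.tailMass E n E.unit = S.μ.real {y | n < S.φ y} := by
  have h1 : ∫ y, {y | n < S.φ y}.indicator (fun _ => (1 : ℂ)) y ∂S.μ =
      S.μ.real {y | n < S.φ y} := by
    rw [integral_indicator_const _ (S.measurableSet_lt_φ n)]
    simp
  rw [tailMass_apply, ← h1]
  refine integral_congr_ae ?_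
  filter_upwards [E.toL1_unit] with y hy
  by_cases h : y ∈ {y | n < S.φ y} <;> simp [h, hy]

variable {S} in
-- The transfer operator preserves integrals, so the mass of `R_{n+1} b` is the integral of `b` over
-- one level of `φ`, a difference of consecutive tails.
theorem IsRenewalFamily.mass_succ {Rn : ℕ → B →L[ℂ] B} (hR : S.IsRenewalFamily E Rn) (n : ℕ)
    (b : B) : E.mass (Rn (n + 1) b) = S.tailMass E n b - S.tailMass E (n + 1) b := by
  have h1 := S.integral_renewalOp_mul (n + 1) (E.toL1 b) (w := fun _ => 1) measurable_const
    ⟨1, fun _ => by simp⟩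
  simp only [mul_one] at h1
  rw [E.mass_apply, hR, h1, tailMass_apply, tailMass_apply, ← integral_sub]
  · refine integral_congr_ae (ae_of_all _ fun y => ?_)
    rcases lt_trichotomy (S.φ y) (n + 1) with h | h | h
    · have : ¬ n < S.φ y := by omega
      have : ¬ n + 1 < S.φ y := by omega
      simp [*, h.ne]
    · simp [h]
    · have : n < S.φ y := by omega
      simp [*, h.ne']
  · exact (L1.integrable_coeFn _).indicator (S.measurableSet_lt_φ _)
  · exact (L1.integrable_coeFn _).indicator (S.measurableSet_lt_φ _)

variable {S} in
theorem IsRenewalFamily.mass_tsum {Rn : ℕ → B →L[ℂ] B} (hR : S.IsRenewalFamily E Rn)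
    (hs : Summable fun n => ‖Rn n‖) (b : B) : E.mass ((∑' m, Rn m) b) = E.mass b := by
  have := hR.integral_tail_mul hs 0 b (w := fun _ => 1) measurable_const (K := 1) fun _ => by simp
  simpa [BanachFunctionSpace.mass, E.pairing_apply] using this

variable {S} in
-- By duality this is the `F`-invariance of `μ`; it supplies the eigenvector for the eigenvalue 1 of
-- `R(1)`.
theorem IsRenewalFamily.tsum_unit {Rn : ℕ → B →L[ℂ] B} (hR : S.IsRenewalFamily E Rn)
    (hs : Summable fun n => ‖Rn n‖) : (∑' m, Rn m) E.unit = E.unit := by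
  apply E.injective
  refine IsTransfer.unique (μ := S.μ) (F := S.F) (u := E.toL1 E.unit) ?_ ?_
  · intro w hw ⟨K, hK⟩
    have := hR.integral_tail_mul hs 0 E.unit hw hK
    simpa [E.pairing_apply] using this
  · intro w hw _
    have h1 : ∫ y, E.toL1 E.unit y * w y ∂S.μ = ∫ y, w y ∂S.μ := by
      refine integral_congr_ae ?_
      filter_upwards [E.toL1_unit] with y hy
      rw [hy, one_mul]
    have h2 : ∫ y, E.toL1 E.unit y * w (S.F y) ∂S.μ = ∫ y, w (S.F y) ∂S.μ := by
      refine integral_congr_ae ?_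
      filter_upwards [E.toL1_unit] with y hy
      rw [hy, one_mul]
    rw [h1, h2]
    conv_lhs => rw [← S.measurePreserving_F.map_eq]
    exact integral_map S.measurable_F.aemeasurable hw.aestronglyMeasurable

/-- The coefficients of `((1 - z)⁻¹ P + (1 - P)) (1 - R(z))`, where `P` is the projection onto the
constants. -/
noncomputable def modifiedCoeff (E : BanachFunctionSpace S.μ B) (Rn : ℕ → B →L[ℂ] B) (n : ℕ) :
    B →L[ℂ] B :=
  (S.tailMass E n).smulRight E.unit +
    (1 - E.mass.smulRight E.unit) * ((if n = 0 then 1 else 0) - Rn n)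

theorem massProj_mul_self (E : BanachFunctionSpace S.μ B) :
    (E.mass.smulRight E.unit : B →L[ℂ] B) * E.mass.smulRight E.unit =
      E.mass.smulRight E.unit := by
  ext b
  change E.mass (E.mass b • E.unit) • E.unit = E.mass b • E.unit
  rw [map_smul, E.mass_unit, smul_eq_mul, mul_one]

variable {S} in
theorem IsRenewalFamily.modifiedCoeff_zero {Rn : ℕ → B →L[ℂ] B} (hR : S.IsRenewalFamily E Rn) :
    S.modifiedCoeff E Rn 0 = 1 := by
  rw [modifiedCoeff, tailMass_zero, hR.zero, if_pos rfl, sub_zero, mul_one, add_sub_cancel]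

theorem _root_.summable_pow_smul {V : Type*} [NormedAddCommGroup V] [NormedSpace ℂ V]
    [CompleteSpace V] {a : ℕ → V} (ha : Summable fun n => ‖a n‖) {z : ℂ} (hz : ‖z‖ ≤ 1) :
    Summable fun n => z ^ n • a n := by
  refine Summable.of_norm_bounded ha fun n => ?_
  rw [norm_smul, norm_pow]
  exact mul_le_of_le_one_left (norm_nonneg _) (pow_le_one₀ (norm_nonneg _) hz)

/-- The power series of the functionals `b ↦ ∫_{φ > n} b dμ`. -/
noncomputable def tailSeries (E : BanachFunctionSpace S.μ B) (z : ℂ) : B →L[ℂ] ℂ :=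
  ∑' n, z ^ n • S.tailMass E n

theorem hasSum_tailSeries (hq : Summable fun n => ‖S.tailMass E n‖) {z : ℂ} (hz : ‖z‖ ≤ 1)
    (b : B) : HasSum (fun n => z ^ n * S.tailMass E n b) (S.tailSeries E z b) := by
  have h := (ContinuousLinearMap.apply ℂ ℂ b).hasSum (summable_pow_smul hq hz).hasSum
  rw [ContinuousLinearMap.apply_apply] at h
  refine h.congr_fun fun n => ?_
  rw [ContinuousLinearMap.apply_apply, _root_.smul_apply, smul_eq_mul]

theorem hasSum_modifiedCoeff {Rn : ℕ → B →L[ℂ] B} (hs : Summable fun n => ‖Rn n‖)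
    (hq : Summable fun n => ‖S.tailMass E n‖) {z : ℂ} (hz : ‖z‖ ≤ 1) :
    HasSum (fun n => z ^ n • S.modifiedCoeff E Rn n)
      ((S.tailSeries E z).smulRight E.unit +
        (1 - E.mass.smulRight E.unit) * (1 - powerSeries Rn z)) := by
  have e1 : HasSum (fun n => z ^ n • (S.tailMass E n).smulRight E.unit)
      ((S.tailSeries E z).smulRight E.unit) := by
    have := ((ContinuousLinearMap.smulRightL ℂ B B).flip E.unit).hasSum
      (summable_pow_smul hq hz).hasSum
    refine this.congr_fun fun n => ?_
    rw [map_smul]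
    rfl
  have e2 : HasSum (fun n => z ^ n • (if n = 0 then (1 : B →L[ℂ] B) else 0)) 1 := by
    convert hasSum_ite_eq 0 (1 : B →L[ℂ] B) using 2 with n
    by_cases hn : n = 0 <;> simp [hn]
  have e3 := e1.add ((e2.sub (summable_pow_smul hs hz).hasSum).mul_left
    (1 - E.mass.smulRight E.unit))
  refine e3.congr_fun fun n => ?_
  rw [modifiedCoeff, smul_add, ← smul_sub, mul_smul_comm]

variable {S} in
-- Summation by parts. The mass of `1 - R(z)` contains the factor `1 - z`, which is why `(1 - z)⁻¹ P
-- (1 - R(z))` extends to `z = 1`.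
theorem IsRenewalFamily.tailSeries_mul {Rn : ℕ → B →L[ℂ] B}
    (hR : S.IsRenewalFamily E Rn) (hs : Summable fun n => ‖Rn n‖)
    (hq : Summable fun n => ‖S.tailMass E n‖) {z : ℂ} (hz : ‖z‖ ≤ 1) (b : B) :
    (1 - z) * S.tailSeries E z b = E.mass b - E.mass (powerSeries Rn z b) := by
  have e1 : HasSum (fun n => z ^ n * E.mass (Rn n b)) (E.mass (powerSeries Rn z b)) := by
    have := E.mass.hasSum ((ContinuousLinearMap.apply ℂ B b).hasSum
      (summable_pow_smul hs hz).hasSum)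
    refine this.congr_fun fun n => ?_
    simp
  have e2 : HasSum (fun n => z ^ (n + 1) * E.mass (Rn (n + 1) b))
      (E.mass (powerSeries Rn z b)) := by
    have := (hasSum_nat_add_iff' 1).2 e1
    simpa [hR.zero] using this
  have happ := S.hasSum_tailSeries hq hz b
  have e3 := (hasSum_nat_add_iff' 1).2 happ
  have e4 := ((happ.mul_left z).sub e3).congr_fun (g := fun n =>
    z ^ (n + 1) * E.mass (Rn (n + 1) b)) fun n => by
      simp only [hR.mass_succ]
      ring
  have e5 := e2.unique e4
  simp only [Finset.sum_range_one, pow_zero, one_mul, tailMass_zero] at e5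
  rw [e5]
  ring

/-- The value is the sum of `μ(φ > n)` over `n`, nonnegative terms of which the first is `1` because
`φ ≥ 1`. -/
theorem tailSeries_one_unit_ne_zero (hq : Summable fun n => ‖S.tailMass E n‖) :
    S.tailSeries E 1 E.unit ≠ 0 := by
  have h2 := S.hasSum_tailSeries hq (z := 1) (by simp) E.unit
  simp only [one_pow, one_mul, tailMass_unit] at h2
  have h3 := Complex.hasSum_re h2
  simp only [Complex.ofReal_re] at h3
  have h4 := le_hasSum h3 0 fun n _ => measureReal_nonneg
  have h5 : {y | 0 < S.φ y} = Set.univ := Set.eq_univ_of_forall fun y => S.φ_pos y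
  rw [h5, probReal_univ] at h4
  intro h0
  rw [h0] at h4
  simp at h4
  linarith

variable {S} in
-- For `z ≠ 1` the regularised operator is a product of two invertible factors. At `z = 1` it is the
-- rank one modification of `1 - R(1)`, invertible by simplicity of the eigenvalue.
theorem IsRenewalFamily.isUnit_tsum_modifiedCoeff {Rn : ℕ → B →L[ℂ] B}
    (hR : S.IsRenewalFamily E Rn) (hs : Summable fun n => ‖Rn n‖)
    (hq : Summable fun n => ‖S.tailMass E n‖)
    (h1 : IsSimpleIsolatedEigenvalue (powerSeries Rn 1) 1)
    (hz : ∀ z : ℂ, ‖z‖ ≤ 1 → z ≠ 1 → (1 : ℂ) ∉ spectrum ℂ (powerSeries Rn z))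
    (z : ℂ) (hz1 : ‖z‖ ≤ 1) : IsUnit (∑' n, z ^ n • S.modifiedCoeff E Rn n) := by
  rw [(S.hasSum_modifiedCoeff hs hq hz1).tsum_eq]
  by_cases hz' : z = 1
  · subst hz'
    have hR1 : powerSeries Rn 1 = ∑' m, Rn m := by simp [powerSeries]
    refine h1.isUnit_modification E.mass_unit ?_ ?_ (S.tailSeries_one_unit_ne_zero hq)
    · rw [hR1, hR.tsum_unit hs]
    · intro b
      rw [hR1, hR.mass_tsum hs]
  · have hz0 : (1 - z) ≠ 0 := sub_ne_zero.2 (Ne.symm hz')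
    have hfac : (S.tailSeries E z).smulRight E.unit +
        (1 - E.mass.smulRight E.unit) * (1 - powerSeries Rn z) =
        ((1 - z)⁻¹ • E.mass.smulRight E.unit + (1 - E.mass.smulRight E.unit)) *
          (1 - powerSeries Rn z) := by
      rw [add_mul]
      congr 1
      ext b
      change S.tailSeries E z b • E.unit =
        (1 - z)⁻¹ • (E.mass (b - powerSeries Rn z b) • E.unit)
      rw [map_sub, ← hR.tailSeries_mul hs hq hz1, smul_smul, inv_mul_cancel_left₀ hz0]
    rw [hfac]
    refine (isUnit_smul_add_one_sub (S.massProj_mul_self E) (inv_ne_zero hz0)).mul ?_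
    have := spectrum.notMem_iff.1 (hz z hz1 hz')
    simpa using this

end InducingScheme

/-! ### Formal factorisation and the renewal equation -/

theorem PowerSeries.coeff_mk_one_mul {A : Type*} [Ring A] (f : PowerSeries A) (n : ℕ) :
    (PowerSeries.mk (fun _ => (1 : A)) * f).coeff n = ∑ i ∈ Finset.range (n + 1), f.coeff i := by
  rw [coeff_mul, ← Finset.Nat.sum_antidiagonal_swap,
    Finset.Nat.sum_antidiagonal_eq_sum_range_succ_mk]
  simp

/-- The factor `(1 - z)⁻¹ P + (1 - P)` as a formal power series. -/
noncomputable def projGeomSeries {A : Type*} [Ring A] (P : A) : PowerSeries A :=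
  PowerSeries.C P * PowerSeries.mk (fun _ => 1) + PowerSeries.C (1 - P)

theorem coeff_projGeomSeries_mul {A : Type*} [Ring A] (P : A) (f : PowerSeries A) (n : ℕ) :
    (projGeomSeries P * f).coeff n =
      P * ∑ i ∈ Finset.range (n + 1), f.coeff i + (1 - P) * f.coeff n := by
  rw [projGeomSeries, add_mul, map_add, mul_assoc, PowerSeries.coeff_C_mul,
    PowerSeries.coeff_mk_one_mul, PowerSeries.coeff_C_mul]

/-- The factorisation as formal series, where `(1 - z)⁻¹` is partial summation: the mass of `b -
∑_{i ≤ n} R_i b` is what remains on `{φ > n}`. -/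
theorem InducingScheme.IsRenewalFamily.mk_modifiedCoeff {X : Type*} [MeasurableSpace X]
    {S : InducingScheme X} {B : Type*} [NormedAddCommGroup B] [NormedSpace ℂ B] [CompleteSpace B]
    {E : BanachFunctionSpace S.μ B} {Rn : ℕ → B →L[ℂ] B} (hR : S.IsRenewalFamily E Rn) :
    PowerSeries.mk (S.modifiedCoeff E Rn) =
      projGeomSeries (E.mass.smulRight E.unit : B →L[ℂ] B) * (1 - PowerSeries.mk Rn) := by
  have hmass : ∀ (n : ℕ) (b : B),
      E.mass (b - ∑ i ∈ Finset.range (n + 1), Rn i b) = S.tailMass E n b := by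
    intro n b
    induction n with
    | zero => simp [hR.zero, S.tailMass_zero]
    | succ n ih =>
      rw [Finset.sum_range_succ, ← sub_sub, map_sub, ih, hR.mass_succ]
      ring
  ext1 n
  rw [coeff_projGeomSeries_mul, PowerSeries.coeff_mk, modifiedCoeff]
  congr 1
  · ext b
    have : (∑ i ∈ Finset.range (n + 1), (1 - PowerSeries.mk Rn).coeff i) b =
        b - ∑ i ∈ Finset.range (n + 1), Rn i b := by
      simp only [map_sub, PowerSeries.coeff_one, PowerSeries.coeff_mk, Finset.sum_sub_distrib]
      rw [Finset.sum_ite_eq' (Finset.range (n + 1)) 0]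
      simp
    change S.tailMass E n b • E.unit = E.mass ((∑ i ∈ Finset.range (n + 1),
      (1 - PowerSeries.mk Rn).coeff i) b) • E.unit
    rw [this, hmass]
  · rw [map_sub, PowerSeries.coeff_one, PowerSeries.coeff_mk]

/-- Bounds for the solution of a renewal equation, from bounds for the inverse of the modified
series. -/
theorem IsDoublingWeight.exists_renewal_bound {lam : ℕ → ℝ} (h : IsDoublingWeight lam)
    {B : Type*} [NormedAddCommGroup B] [NormedSpace ℂ B] {e : B} {p : B →L[ℂ] ℂ} (hpe : p e = 1)
    {R : ℕ → B →L[ℂ] B} (hR0 : R 0 = 0) {N : PowerSeries (B →L[ℂ] B)}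
    (hN : N * (projGeomSeries (p.smulRight e) * (1 - PowerSeries.mk R)) = 1) {K : ℝ}
    (hK : ∀ n, 1 ≤ n → ‖N.coeff n‖ ≤ K * (lam n / n)) {κ : ℝ} (hκ : 0 ≤ κ) :
    ∃ C, 0 ≤ C ∧ ∀ (J A : ℕ → B →L[ℂ] ℂ) (b : ℕ → B) (L W : ℝ), 0 ≤ W →
      (∀ m x, J m x = A m x + ∑ q ∈ Finset.HasAntidiagonal.antidiagonal m, J q.1 (R q.2 x)) →
      (∀ n, 1 ≤ n → ‖A n‖ ≤ W * (κ * (lam n / n))) → ‖A 0‖ ≤ W * κ →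
      (∀ n, ‖b n‖ ≤ L * weightTail lam n) →
      (∀ n, ‖p (∑ i ∈ Finset.range (n + 1), b i)‖ ≤ L * weightTail lam n) →
      ∀ n, ‖∑ q ∈ Finset.HasAntidiagonal.antidiagonal n, J q.1 (b q.2)‖ ≤
        C * W * L * weightTail lam n := by
  have hK0 : 0 ≤ K := nonneg_of_mul_nonneg_left ((norm_nonneg _).trans (hK 1 le_rfl))
    (div_pos (h.pos 1) (by norm_num))
  obtain ⟨C₁, hC₁, hconv₁⟩ := h.convolution_le (K := max K ‖N.coeff 0‖) (le_max_of_le_left hK0)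
  obtain ⟨C₂, hC₂, hconv₂⟩ := h.convolution_le (K := κ * ‖e‖) (by positivity)
  set P : B →L[ℂ] B := p.smulRight e with hP
  refine ⟨‖p‖ * (C₂ * (C₁ * (‖p‖ * ‖e‖ + ‖1 - P‖ * ‖p‖))) * ‖e‖, by positivity, ?_⟩
  intro J A b L W hW hJ hA hA0 hb hpb n
  -- Functionals are tensored with `e` and vectors with `p`, so that all series live in one operator
  -- algebra; `p e = 1` recovers the scalars at the end.
  set bJ : PowerSeries (B →L[ℂ] B) := PowerSeries.mk fun m => (J m).smulRight e with hbJ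
  set bA : PowerSeries (B →L[ℂ] B) := PowerSeries.mk fun m => (A m).smulRight e with hbA
  set bB : PowerSeries (B →L[ℂ] B) := PowerSeries.mk fun m => p.smulRight (b m) with hbB
  have hJA : bJ * (1 - PowerSeries.mk R) = bA := by
    ext m x
    rw [mul_sub, mul_one, map_sub, PowerSeries.coeff_mul]
    simp only [hbJ, hbA, PowerSeries.coeff_mk]
    change J m x • e - (∑ q ∈ Finset.HasAntidiagonal.antidiagonal m,
      ((J q.1).smulRight e : B →L[ℂ] B) * R q.2) x = A m x • e
    rw [_root_.sum_apply]
    change J m x • e - ∑ q ∈ Finset.HasAntidiagonal.antidiagonal m, J q.1 (R q.2 x) • e = _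
    rw [hJ, ← Finset.sum_smul, ← sub_smul, add_sub_cancel_right]
  set U : PowerSeries (B →L[ℂ] B) :=
    PowerSeries.invOfUnit (1 - PowerSeries.mk R) 1 * bB with hU
  have hRU : (1 - PowerSeries.mk R) * U = bB := by
    rw [hU, ← mul_assoc, PowerSeries.mul_invOfUnit, one_mul]
    rw [← PowerSeries.coeff_zero_eq_constantCoeff_apply]
    simp [hR0]
  -- The formal solution `U = (1 - R)⁻¹ β` carries no bounds; this rewriting gives them, since `N`
  -- inverts the regularised series.
  have hUN : U = N * (projGeomSeries P * bB) := by
    rw [← hRU, ← mul_assoc (projGeomSeries P), ← mul_assoc, hN, one_mul]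
  have hWn : ∀ m, ‖(projGeomSeries P * bB).coeff m‖ ≤
      ((‖p‖ * ‖e‖ + ‖1 - P‖ * ‖p‖) * L) * weightTail lam m := by
    intro m
    rw [coeff_projGeomSeries_mul]
    -- The `(1 - z)⁻¹ P` part sees only `p` of the partial sums, which is where the mean-zero
    -- hypothesis will act.
    have e1 : P * ∑ i ∈ Finset.range (m + 1), bB.coeff i =
        p.smulRight (p (∑ i ∈ Finset.range (m + 1), b i) • e) := by
      ext x
      have : (∑ i ∈ Finset.range (m + 1), bB.coeff i) x =
          p x • ∑ i ∈ Finset.range (m + 1), b i := by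
        simp only [hbB, PowerSeries.coeff_mk]
        rw [_root_.sum_apply, Finset.smul_sum]
        rfl
      change p ((∑ i ∈ Finset.range (m + 1), bB.coeff i) x) • e = p x • _
      rw [this, map_smul, smul_smul, smul_eq_mul]
    rw [e1]
    refine (norm_add_le _ _).trans ?_
    have e2 : ‖p.smulRight (p (∑ i ∈ Finset.range (m + 1), b i) • e)‖ ≤
        ‖p‖ * ((L * weightTail lam m) * ‖e‖) := by
      rw [ContinuousLinearMap.norm_smulRight_apply, norm_smul]
      gcongr
      exact hpb m
    have e3 : ‖(1 - P) * bB.coeff m‖ ≤ ‖1 - P‖ * (‖p‖ * (L * weightTail lam m)) := by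
      refine (norm_mul_le _ _).trans ?_
      rw [hbB, PowerSeries.coeff_mk, ContinuousLinearMap.norm_smulRight_apply]
      gcongr
      exact hb m
    linarith
  have hUn : ∀ m, ‖U.coeff m‖ ≤
      (C₁ * ((‖p‖ * ‖e‖ + ‖1 - P‖ * ‖p‖) * L)) * weightTail lam m := by
    intro m
    refine le_trans ?_ (hconv₁ (a := fun i => ‖N.coeff i‖)
      (x := fun i => ‖(projGeomSeries P * bB).coeff i‖) (fun _ => norm_nonneg _)
      (fun _ => norm_nonneg _) (fun i hi => (hK i hi).trans
        (mul_le_mul_of_nonneg_right (le_max_left _ _) (h.div_nonneg' i))) (le_max_right _ _) hWn m)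
    rw [hUN, PowerSeries.coeff_mul]
    exact norm_sum_le_of_le _ fun q _ => norm_mul_le _ _
  have hAU : ‖(bA * U).coeff n‖ ≤
      W * (C₂ * (C₁ * ((‖p‖ * ‖e‖ + ‖1 - P‖ * ‖p‖) * L)) * weightTail lam n) := by
    set a : ℕ → ℝ := fun i => if i = 0 then κ * ‖e‖ else κ * ‖e‖ * (lam i / i) with ha
    have ha0 : ∀ i, 0 ≤ a i := fun i => by
      have := h.div_nonneg' i
      simp only [ha]
      split_ifs <;> positivity
    have hAa : ∀ i, ‖bA.coeff i‖ ≤ W * a i := fun i => by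
      rw [hbA, PowerSeries.coeff_mk, ContinuousLinearMap.norm_smulRight_apply]
      simp only [ha]
      split_ifs with hi
      · rw [hi, ← mul_assoc]
        exact mul_le_mul_of_nonneg_right hA0 (norm_nonneg _)
      · have := mul_le_mul_of_nonneg_right (hA i (by omega)) (norm_nonneg e)
        linarith
    have h2 := hconv₂ (a := a) (x := fun i => ‖U.coeff i‖) ha0 (fun _ => norm_nonneg _)
      (fun i hi => by simp only [ha]; rw [if_neg (by omega)]) (by simp [ha]) hUn n
    refine le_trans ?_ (mul_le_mul_of_nonneg_left h2 hW)
    rw [PowerSeries.coeff_mul, Finset.mul_sum]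
    refine norm_sum_le_of_le _ fun q _ => (norm_mul_le _ _).trans ?_
    rw [← mul_assoc]
    exact mul_le_mul_of_nonneg_right (hAa _) (norm_nonneg _)
  have hfin : ∑ q ∈ Finset.HasAntidiagonal.antidiagonal n, J q.1 (b q.2) =
      p ((bA * U).coeff n e) := by
    rw [← hJA, mul_assoc, hRU, PowerSeries.coeff_mul, _root_.sum_apply, map_sum]
    refine Finset.sum_congr rfl fun q _ => ?_
    simp only [hbJ, hbB, PowerSeries.coeff_mk]
    change _ = p (J q.1 (p e • b q.2) • e)
    rw [hpe, one_smul, map_smul, hpe, smul_eq_mul, mul_one]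
  rw [hfin]
  calc ‖p ((bA * U).coeff n e)‖ ≤ ‖p‖ * (‖(bA * U).coeff n‖ * ‖e‖) :=
        (p.le_opNorm _).trans (mul_le_mul_of_nonneg_left (ContinuousLinearMap.le_opNorm _ _)
          (norm_nonneg _))
    _ ≤ ‖p‖ * ((W * (C₂ * (C₁ * ((‖p‖ * ‖e‖ + ‖1 - P‖ * ‖p‖) * L)) * weightTail lam n)) *
          ‖e‖) := by gcongr
    _ = _ := by ring

/-! ### Correlations as renewal sums -/

namespace InducingScheme

variable {X : Type*} [MeasurableSpace X] (S : InducingScheme X)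

theorem integrable_mul_comp_iterate {v : X → ℝ} (hv : Integrable v S.μX) {ω : X → ℂ}
    (hω : Measurable ω) {W : ℝ} (hW : ∀ x, ‖ω x‖ ≤ W) (n : ℕ) :
    Integrable (fun x => (v x : ℂ) * ω (S.T^[n] x)) S.μX :=
  hv.ofReal.mul_bdd (c := W) (hω.comp (S.measurable_iterate n)).aestronglyMeasurable
    (ae_of_all _ fun _ => hW _)

/-- An observable that is bounded on the columns of the tower is bounded in mean. -/
theorem norm_integral_mul_le {v : X → ℝ} (hv : Integrable v S.μX) {V : ℝ}
    (hV : ∀ᵐ y ∂S.μ, ∀ l < S.φ y, |v (S.T^[l] (y : X))| ≤ V) {ω : X → ℂ}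
    (hω : Measurable ω) {W : ℝ} (hW : ∀ x, ‖ω x‖ ≤ W) (n : ℕ) :
    ‖∫ x, (v x : ℂ) * ω (S.T^[n] x) ∂S.μX‖ ≤ V * W := by
  have hm : 0 < S.meanTime := one_pos.trans_le S.one_le_meanTime
  have h1 := (S.integral_μX (S.integrable_mul_comp_iterate hv hω hW n)).2
  have h2 : ‖∫ y, S.columnSum (fun x => (v x : ℂ) * ω (S.T^[n] x)) y ∂S.μ‖ ≤
      ∫ y, (V * W) * S.φ y ∂S.μ := by
    refine norm_integral_le_of_norm_le (S.integrable_φ.const_mul _) ?_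
    filter_upwards [hV] with y hy
    refine (norm_sum_le_of_le (f := fun l => (v (S.T^[l] (y : X)) : ℂ) *
      ω (S.T^[n] (S.T^[l] (y : X)))) (n := fun _ => V * W) _ fun l hl => ?_).trans (le_of_eq ?_)
    · have hl' := hy l (Finset.mem_range.1 hl)
      rw [norm_mul, Complex.norm_real, Real.norm_eq_abs]
      exact mul_le_mul hl' (hW _) (norm_nonneg _) ((abs_nonneg _).trans hl')
    · simp [mul_comm]
  rw [h1, integral_const_mul, ← meanTime, norm_mul, Complex.norm_real,
    Real.norm_of_nonneg hm.le, mul_comm] at h2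
  exact le_of_mul_le_mul_right h2 hm

variable {B : Type*} [NormedAddCommGroup B] [NormedSpace ℂ B] [CompleteSpace B]
  {E : BanachFunctionSpace S.μ B}

/-- Every observable derived from `v` is represented by an element of `B` of norm at most `V`. -/
def HasDerivedBound (E : BanachFunctionSpace S.μ B) (v : X → ℝ) (V : ℝ) : Prop :=
  ∀ u ∈ S.derived v, ∃ b : B, (E.toL1 b =ᵐ[S.μ] fun y => (u y : ℂ)) ∧ ‖b‖ ≤ V

variable {S} in
-- The point at height `l` is read by `before v j` with `j = φ y - l`. Countably many derived
-- observables thus see every point of the column, and each is essentially bounded through the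
-- embedding.
theorem HasDerivedBound.column_bound {v : X → ℝ} {V : ℝ} (hv : S.HasDerivedBound E v V) {K : ℝ}
    (hK : 0 ≤ K) (hE : ∀ b, ∀ᵐ y ∂S.μ, ‖E.toL1 b y‖ ≤ K * ‖b‖) :
    ∀ᵐ y ∂S.μ, ∀ l < S.φ y, |v (S.T^[l] (y : X))| ≤ K * V := by
  have h1 : ∀ j : ℕ, ∀ᵐ y ∂S.μ, |S.before v (j + 1) y| ≤ K * V := by
    intro j
    obtain ⟨b, hb, hbV⟩ := hv _ (S.before_mem_derived v (Nat.le_add_left 1 j))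
    filter_upwards [hb, hE b] with y hy1 hy2
    rw [hy1, Complex.norm_real, Real.norm_eq_abs] at hy2
    exact hy2.trans (by gcongr)
  filter_upwards [ae_all_iff.2 h1] with y hy l hl
  have h2 := hy (S.φ y - l - 1)
  rw [before, if_pos (by omega)] at h2
  rwa [show S.φ y - (S.φ y - l - 1 + 1) = l by omega] at h2

/-- The functional `b ↦ ∫ b (ω ∘ Tᵐ) dμ`. -/
noncomputable def iteratePairing (E : BanachFunctionSpace S.μ B) {ω : X → ℂ} (hω : Measurable ω)
    {W : ℝ} (hW : ∀ x, ‖ω x‖ ≤ W) (m : ℕ) : B →L[ℂ] ℂ :=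
  E.pairing (w := fun y => ω (S.T^[m] (y : X))) (hω.comp (S.measurable_iterate_coe m))
    (K := W) fun _ => hW _

/-- The functional `b ↦ ∫_{φ > m} b (ω ∘ Tᵐ) dμ`. -/
noncomputable def excursionPairing (E : BanachFunctionSpace S.μ B) {ω : X → ℂ}
    (hω : Measurable ω) {W : ℝ} (hW0 : 0 ≤ W) (hW : ∀ x, ‖ω x‖ ≤ W) (m : ℕ) : B →L[ℂ] ℂ :=
  E.pairing (w := {y | m < S.φ y}.indicator fun y => ω (S.T^[m] (y : X)))
    ((hω.comp (S.measurable_iterate_coe m)).indicator (S.measurableSet_lt_φ m)) (K := W) fun y => by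
      by_cases h : y ∈ {y | m < S.φ y}
      · rw [Set.indicator_of_mem h]; exact hW _
      · rw [Set.indicator_of_notMem h, norm_zero]; exact hW0

variable {S} in
/-- Decomposition according to the first return to the base. -/
theorem IsRenewalFamily.iteratePairing_eq {Rn : ℕ → B →L[ℂ] B} (hR : S.IsRenewalFamily E Rn)
    {ω : X → ℂ} (hω : Measurable ω) {W : ℝ} (hW0 : 0 ≤ W) (hW : ∀ x, ‖ω x‖ ≤ W) (m : ℕ) (b : B) :
    S.iteratePairing E hω hW m b = S.excursionPairing E hω hW0 hW m b +
      ∑ q ∈ Finset.HasAntidiagonal.antidiagonal m, S.iteratePairing E hω hW q.1 (Rn q.2 b) := by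
  set g : S.Y → ℂ := fun y => E.toL1 b y * ω (S.T^[m] (y : X)) with hg
  have hgi : Integrable g S.μ :=
    integrable_Lp_mul _ (hω.comp (S.measurable_iterate_coe m)) fun y => hW _
  have h1 : ∀ q ∈ Finset.HasAntidiagonal.antidiagonal m,
      S.iteratePairing E hω hW q.1 (Rn q.2 b) =
        ∫ y, {y | S.φ y = q.2}.indicator g y ∂S.μ := by
    intro q hq
    have hq' := Finset.HasAntidiagonal.mem_antidiagonal.1 hq
    rw [iteratePairing, E.pairing_apply, hR, S.integral_renewalOp_mul q.2 _
      (w := fun y => ω (S.T^[q.1] (y : X))) (hω.comp (S.measurable_iterate_coe q.1))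
      ⟨W, fun y => hW _⟩]
    refine integral_congr_ae (ae_of_all _ fun y => ?_)
    by_cases hy : S.φ y = q.2
    · simp only [Set.indicator_of_mem (show y ∈ {y | S.φ y = q.2} from hy), hg, F,
        ← Function.iterate_add_apply]
      rw [hy, hq']
    · simp only [Set.indicator_of_notMem (show y ∉ {y | S.φ y = q.2} from hy)]
  rw [Finset.sum_congr rfl h1, ← integral_finsetSum _ fun q _ =>
    hgi.indicator (S.measurableSet_level q.2), iteratePairing, excursionPairing, E.pairing_apply,
    E.pairing_apply, ← integral_add]
  · refine integral_congr_ae (ae_of_all _ fun y => ?_)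
    simp only
    have h2 : ∑ q ∈ Finset.HasAntidiagonal.antidiagonal m, {y | S.φ y = q.2}.indicator g y =
        ∑ k ∈ Finset.range (m + 1), if k = S.φ y then g y else 0 := by
      rw [← Finset.Nat.sum_antidiagonal_swap, Finset.Nat.sum_antidiagonal_eq_sum_range_succ_mk]
      refine Finset.sum_congr rfl fun k _ => ?_
      by_cases hy : k = S.φ y
      · rw [if_pos hy]; exact Set.indicator_of_mem (show y ∈ {y | S.φ y = k} from hy.symm) g
      · rw [if_neg hy]; exact Set.indicator_of_notMem (show y ∉ {y | S.φ y = k} from fun h => hy h.symm) g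
    rw [h2, Finset.sum_ite_eq']
    by_cases hy : m < S.φ y
    · rw [Set.indicator_of_mem (show y ∈ {y | m < S.φ y} from hy), if_neg, add_zero]
      rw [Finset.mem_range]; omega
    · rw [Set.indicator_of_notMem (show y ∉ {y | m < S.φ y} from hy), if_pos, mul_zero, zero_add]
      rw [Finset.mem_range]; omega
  · exact integrable_Lp_mul _ ((hω.comp (S.measurable_iterate_coe m)).indicator
      (S.measurableSet_lt_φ m)) (K := W) fun y => by
        by_cases h : y ∈ {y | m < S.φ y}
        · rw [Set.indicator_of_mem h]; exact hW _
        · rw [Set.indicator_of_notMem h, norm_zero]; exact hW0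
  · exact integrable_finsetSum _ fun q _ => hgi.indicator (S.measurableSet_level q.2)

variable {S} in
/-- The correlation integral as a renewal sum, up to orbits that have not returned yet. -/
theorem IsRenewalFamily.norm_sub_le {Rn : ℕ → B →L[ℂ] B} (hR : S.IsRenewalFamily E Rn)
    (hs : Summable fun n => ‖Rn n‖) {v : X → ℝ} (hv : Integrable v S.μX) {V : ℝ}
    (hV : ∀ᵐ y ∂S.μ, ∀ l < S.φ y, |v (S.T^[l] (y : X))| ≤ V) {b : ℕ → B}
    (hb : ∀ j, E.toL1 (b (j + 1)) =ᵐ[S.μ] fun y => (S.before v (j + 1) y : ℂ))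
    {ω : X → ℂ} (hω : Measurable ω) {W : ℝ} (hW : ∀ x, ‖ω x‖ ≤ W) (n : ℕ) :
    ‖S.meanTime * ∫ x, (v x : ℂ) * ω (S.T^[n] x) ∂S.μX - ∑ j ∈ Finset.range n,
      S.iteratePairing E hω hW (n - (j + 1)) ((∑' m, Rn (m + (j + 1))) (b (j + 1)))‖ ≤
      V * W * S.tailMean n := by
  obtain ⟨hint, heq⟩ := S.integral_μX (S.integrable_mul_comp_iterate hv hω hW n)
  set g : ℕ → S.Y → ℂ := fun j => {y | j + 1 ≤ S.φ y}.indicator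
    (fun y => (S.before v (j + 1) y : ℂ) * ω (S.T^[n - (j + 1)] (S.F y : X))) with hg
  have hgm : ∀ j, Measurable fun y : S.Y => ω (S.T^[n - (j + 1)] (y : X)) := fun j =>
    hω.comp (S.measurable_iterate_coe _)
  have hge : ∀ j, {y | j + 1 ≤ S.φ y}.indicator (fun y => E.toL1 (b (j + 1)) y *
      ω (S.T^[n - (j + 1)] (S.F y : X))) =ᵐ[S.μ] g j := by
    intro j
    filter_upwards [hb j] with y hy
    by_cases h : y ∈ {y | j + 1 ≤ S.φ y}
    · simp only [hg, Set.indicator_of_mem h, hy]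
    · simp only [hg, Set.indicator_of_notMem h]
  have hgi : ∀ j, Integrable (g j) S.μ := fun j =>
    ((S.integrable_mul_comp_F (E.toL1 (b (j + 1))) (hgm j) ⟨W, fun y => hW _⟩).indicator
      (S.measurableSet_le_φ (j + 1))).congr (hge j)
  have hgp : ∀ j, S.iteratePairing E hω hW (n - (j + 1))
      ((∑' m, Rn (m + (j + 1))) (b (j + 1))) = ∫ y, g j y ∂S.μ := fun j => by
    rw [← integral_congr_ae (hge j)]
    exact hR.integral_tail_mul hs (j + 1) (b (j + 1)) (hgm j) _
  simp only [hgp]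
  rw [← heq, ← integral_finsetSum _ fun j _ => hgi j,
    ← integral_sub hint (integrable_finsetSum _ fun j _ => hgi j), tailMean, ← integral_const_mul]
  refine norm_integral_le_of_norm_le ((S.integrable_φ_sub n).const_mul _) ?_
  filter_upwards [hV] with y hy
  rw [S.columnSum_mul_eq, add_sub_cancel_right]
  refine (norm_sum_le_of_le (f := fun l => (v (S.T^[l] (y : X)) : ℂ) *
      ω (S.T^[l + n] (y : X))) (n := fun _ => V * W) _ fun l hl => ?_).trans (le_of_eq ?_)
  · have hl' := hy l (by have := Finset.mem_range.1 hl; omega)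
    rw [norm_mul, Complex.norm_real, Real.norm_eq_abs]
    exact mul_le_mul hl' (hW _) (norm_nonneg _) ((abs_nonneg _).trans hl')
  · simp [mul_comm]

/-- `{φ ≥ n}` is `{φ > n - 1}`, and doubling absorbs the shift. The summand `1 / lam 1` serves `n =
1`, where the hypothesis says nothing about `n - 1`. -/
theorem exists_measureReal_le {lam : ℕ → ℝ} (h : IsDoublingWeight lam) {C : ℝ}
    (hC : ∀ n, 1 ≤ n → S.μ.real {y | n < S.φ y} ≤ C * (lam n / n)) :
    ∃ C', 0 ≤ C' ∧ ∀ n, 1 ≤ n → S.μ.real {y | n ≤ S.φ y} ≤ C' * (lam n / n) := by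
  have hC0 : 0 ≤ C := nonneg_of_mul_nonneg_left (measureReal_nonneg.trans (hC 1 le_rfl))
    (div_pos (h.pos 1) (by norm_num))
  obtain ⟨D, hD, hhalf⟩ := h.half
  have h1 := h.pos 1
  refine ⟨2 * C * D + 1 / lam 1, by positivity, fun n hn => ?_⟩
  rcases Nat.lt_or_ge n 2 with hn2 | hn2
  · obtain rfl : n = 1 := by omega
    have : S.μ.real {y | 1 ≤ S.φ y} ≤ 1 := measureReal_le_one
    refine this.trans ?_
    rw [Nat.cast_one, div_one, add_mul, one_div_mul_cancel h1.ne']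
    have : 0 ≤ 2 * C * D * lam 1 := by positivity
    linarith
  · have hset : {y | n ≤ S.φ y} = {y | n - 1 < S.φ y} := by
      ext y
      simp only [Set.mem_ofPred_eq]
      omega
    have hn0 : (0 : ℝ) < n := Nat.cast_pos.2 (by omega)
    have hln := h.pos n
    rw [hset]
    calc S.μ.real {y | n - 1 < S.φ y} ≤ C * (lam (n - 1) / (n - 1 : ℕ)) := hC _ (by omega)
      _ ≤ C * ((D * lam n) / (n / 2)) := by
          refine mul_le_mul_of_nonneg_left ?_ hC0
          refine div_le_div₀ (by positivity) ((h.anti (by omega)).trans (hhalf n))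
            (by positivity) ?_
          rw [div_le_iff₀ two_pos]
          exact_mod_cast (by omega : n ≤ (n - 1) * 2)
      _ = 2 * C * D * (lam n / n) := by field_simp
      _ ≤ _ := by
          refine mul_le_mul_of_nonneg_right ?_ (h.div_nonneg' n)
          have : 0 ≤ 1 / lam 1 := by positivity
          linarith

end InducingScheme

/-! ### Decay for observables of mean zero -/

namespace InducingScheme

/-- The element `∑_{m ≥ j} R_m b_j` of `B`. -/
noncomputable def returnDensity {B : Type*} [NormedAddCommGroup B] [NormedSpace ℂ B]
    (Rn : ℕ → B →L[ℂ] B) (b : ℕ → B) (j : ℕ) : B :=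
  if j = 0 then 0 else (∑' m, Rn (m + j)) (b j)

theorem returnDensity_zero {B : Type*} [NormedAddCommGroup B] [NormedSpace ℂ B]
    (Rn : ℕ → B →L[ℂ] B) (b : ℕ → B) : returnDensity Rn b 0 = 0 := if_pos rfl

theorem returnDensity_succ {B : Type*} [NormedAddCommGroup B] [NormedSpace ℂ B]
    (Rn : ℕ → B →L[ℂ] B) (b : ℕ → B) (j : ℕ) :
    returnDensity Rn b (j + 1) = (∑' m, Rn (m + (j + 1))) (b (j + 1)) := if_neg (by omega)

variable {X : Type*} [MeasurableSpace X] (S : InducingScheme X)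
  {B : Type*} [NormedAddCommGroup B] [NormedSpace ℂ B] [CompleteSpace B]
  {E : BanachFunctionSpace S.μ B}

theorem norm_tailMass_le {K : ℝ} (hK : 0 ≤ K) (hE : ∀ b, ∀ᵐ y ∂S.μ, ‖E.toL1 b y‖ ≤ K * ‖b‖)
    (n : ℕ) : ‖S.tailMass E n‖ ≤ K * S.μ.real {y | n < S.φ y} := by
  have := E.norm_pairing_le hE hK (w := {y | n < S.φ y}.indicator fun _ => 1)
    (measurable_const.indicator (S.measurableSet_lt_φ n)) zero_le_one (fun y => by
      by_cases h : y ∈ {y | n < S.φ y} <;> simp [h]) (S.measurableSet_lt_φ n)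
    fun y hy => Set.indicator_of_notMem hy _
  rwa [mul_one] at this

theorem norm_excursionPairing_le {K : ℝ} (hK : 0 ≤ K)
    (hE : ∀ b, ∀ᵐ y ∂S.μ, ‖E.toL1 b y‖ ≤ K * ‖b‖) {ω : X → ℂ} (hω : Measurable ω) {W : ℝ}
    (hW0 : 0 ≤ W) (hW : ∀ x, ‖ω x‖ ≤ W) (m : ℕ) :
    ‖S.excursionPairing E hω hW0 hW m‖ ≤ K * W * S.μ.real {y | m < S.φ y} :=
  E.norm_pairing_le hE hK _ hW0 _ (S.measurableSet_lt_φ m)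
    fun _ hy => Set.indicator_of_notMem hy _

theorem _root_.IsDoublingWeight.summable_norm {lam : ℕ → ℝ} (h : IsDoublingWeight lam) {V : Type*}
    [NormedAddCommGroup V] {a : ℕ → V} {c : ℝ} (ha : ∀ n, 1 ≤ n → ‖a n‖ ≤ c * (lam n / n)) :
    Summable fun n => ‖a n‖ :=
  (summable_nat_add_iff 1).1 (Summable.of_nonneg_of_le (fun _ => norm_nonneg _)
    (fun n => ha (n + 1) (by omega)) (((summable_nat_add_iff 1).2 h.summable).mul_left c))

theorem _root_.IsDoublingWeight.norm_tsum_le {lam : ℕ → ℝ} (h : IsDoublingWeight lam) {V : Type*}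
    [NormedAddCommGroup V] {a : ℕ → V} {c : ℝ} (ha : ∀ n, 1 ≤ n → ‖a n‖ ≤ c * (lam n / n)) {j : ℕ}
    (hj : 1 ≤ j) : ‖∑' m, a (m + j)‖ ≤ c * weightTail lam j := by
  have hs := (summable_nat_add_iff j).2 (h.summable_norm ha)
  rw [weightTail, ← tsum_mul_left]
  exact (norm_tsum_le_tsum_norm hs).trans (hs.tsum_le_tsum
    (fun m => ha _ (by omega)) ((h.summable_add j).mul_left c))

/-- The renewal operators of an excellent scheme, with their norm bounds and the inverse of the
modified renewal series. -/
theorem IsExcellent.exists_inverse (hS : S.IsExcellent E) {K : ℝ} (hK : 0 ≤ K)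
    (hE : ∀ b, ∀ᵐ y ∂S.μ, ‖E.toL1 b y‖ ≤ K * ‖b‖) {lam : ℕ → ℝ} (h : IsDoublingWeight lam)
    {Ct : ℝ} (hCt : ∀ n, 1 ≤ n → S.μ.real {y | n < S.φ y} ≤ Ct * (lam n / n)) :
    ∃ Rn : ℕ → B →L[ℂ] B, S.IsRenewalFamily E Rn ∧
      (∃ C, 0 ≤ C ∧ ∀ n, 1 ≤ n → ‖Rn n‖ ≤ C * (lam n / n)) ∧
      ∃ N : PowerSeries (B →L[ℂ] B),
        N * (projGeomSeries (E.mass.smulRight E.unit) * (1 - PowerSeries.mk Rn)) = 1 ∧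
        ∃ C, ∀ n, 1 ≤ n → ‖N.coeff n‖ ≤ C * (lam n / n) := by
  obtain ⟨Rn, hR, ⟨C₀, hC₀⟩, hsimple, hspec⟩ := hS
  replace hR : S.IsRenewalFamily E Rn := hR
  obtain ⟨C₁, hC₁, hφ⟩ := S.exists_measureReal_le h hCt
  set CR : ℝ := |C₀| * C₁ with hCR
  have hRn : ∀ n, 1 ≤ n → ‖Rn n‖ ≤ CR * (lam n / n) := fun n hn =>
    calc ‖Rn n‖ ≤ C₀ * S.μ.real {y | n ≤ S.φ y} := hC₀ n hn
      _ ≤ |C₀| * S.μ.real {y | n ≤ S.φ y} :=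
          mul_le_mul_of_nonneg_right (le_abs_self _) measureReal_nonneg
      _ ≤ |C₀| * (C₁ * (lam n / n)) := mul_le_mul_of_nonneg_left (hφ n hn) (abs_nonneg _)
      _ = _ := by rw [hCR]; ring
  have htn : ∀ n, 1 ≤ n → ‖S.tailMass E n‖ ≤ (K * Ct) * (lam n / n) := fun n hn => by
    rw [mul_assoc]
    exact (S.norm_tailMass_le hK hE n).trans (mul_le_mul_of_nonneg_left (hCt n hn) hK)
  -- Nontriviality gives the operator algebra a unit of norm one, as the Wiener lemma requires.
  have : Nontrivial B := ⟨E.unit, 0, fun h0 => by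
    have := E.mass_unit
    rw [h0, map_zero] at this
    exact zero_ne_one this⟩
  have hMn : ∀ n, 1 ≤ n → ‖S.modifiedCoeff E Rn n‖ ≤
      (K * Ct * ‖E.unit‖ + ‖1 - E.mass.smulRight E.unit‖ * CR) * (lam n / n) := fun n hn => by
    rw [modifiedCoeff, if_neg (by omega), zero_sub]
    refine (norm_add_le _ _).trans ?_
    rw [ContinuousLinearMap.norm_smulRight_apply]
    have h1 := mul_le_mul_of_nonneg_right (htn n hn) (norm_nonneg E.unit)
    have h2 : ‖(1 - E.mass.smulRight E.unit) * -Rn n‖ ≤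
        ‖1 - E.mass.smulRight E.unit‖ * (CR * (lam n / n)) := by
      refine (norm_mul_le _ _).trans ?_
      rw [norm_neg]
      exact mul_le_mul_of_nonneg_left (hRn n hn) (norm_nonneg _)
    linarith
  obtain ⟨N, hN, KN, -, hNn⟩ := h.exists_inverse hR.modifiedCoeff_zero hMn
    (hR.isUnit_tsum_modifiedCoeff (h.summable_norm hRn) (h.summable_norm htn) hsimple hspec)
  rw [hR.mk_modifiedCoeff] at hN
  exact ⟨Rn, hR, ⟨CR, by positivity, hRn⟩, N, hN, KN, hNn⟩

variable {S} in
theorem HasDerivedBound.exists_before {v : X → ℝ} {V : ℝ} (hv : S.HasDerivedBound E v V) :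
    ∃ b : ℕ → B, (∀ j, E.toL1 (b (j + 1)) =ᵐ[S.μ] fun y => (S.before v (j + 1) y : ℂ)) ∧
      ∀ j, ‖b (j + 1)‖ ≤ V := by
  choose b hb hbV using fun j : ℕ => hv _ (S.before_mem_derived v (Nat.le_add_left 1 j))
  exact ⟨fun j => b (j - 1), hb, hbV⟩

variable {S} in
/-- The masses of the partial sums of the renewal data of an observable of mean zero. -/
theorem IsRenewalFamily.norm_mass_sum_le {Rn : ℕ → B →L[ℂ] B} (hR : S.IsRenewalFamily E Rn)
    (hs : Summable fun n => ‖Rn n‖) {v : X → ℝ} (hv : Integrable v S.μX)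
    (hv0 : ∫ x, v x ∂S.μX = 0) {V : ℝ}
    (hV : ∀ᵐ y ∂S.μ, ∀ l < S.φ y, |v (S.T^[l] (y : X))| ≤ V) {b : ℕ → B}
    (hb : ∀ j, E.toL1 (b (j + 1)) =ᵐ[S.μ] fun y => (S.before v (j + 1) y : ℂ)) (m : ℕ) :
    ‖E.mass (∑ j ∈ Finset.range m, (∑' k, Rn (k + (j + 1))) (b (j + 1)))‖ ≤ V * S.tailMean m := by
  -- With `ω = 1` every pairing is the total mass and the correlation integral is `∫ v = 0`, so the
  -- renewal sum is bounded by the error term alone.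
  have h1 := hR.norm_sub_le hs hv hV hb (ω := fun _ => 1) measurable_const (W := 1)
    (fun _ => by simp) m
  have h2 : ∫ x, (v x : ℂ) * 1 ∂S.μX = 0 := by
    simp only [mul_one]
    rw [integral_complex_ofReal, hv0, Complex.ofReal_zero]
  rw [h2, mul_zero, zero_sub, norm_neg, mul_one] at h1
  rw [map_sum]
  exact h1

theorem norm_returnDensity_le {Rn : ℕ → B →L[ℂ] B} {b : ℕ → B} {lam : ℕ → ℝ}
    (h : IsDoublingWeight lam) {c V : ℝ} (hc : 0 ≤ c) (hV : 0 ≤ V)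
    (hRn : ∀ n, 1 ≤ n → ‖Rn n‖ ≤ c * (lam n / n)) (hb : ∀ j, ‖b (j + 1)‖ ≤ V) (j : ℕ) :
    ‖returnDensity Rn b j‖ ≤ c * V * weightTail lam j := by
  have h0 := h.weightTail_nonneg j
  rcases j with _ | j
  · rw [returnDensity_zero, norm_zero]; positivity
  · rw [returnDensity_succ]
    calc _ ≤ ‖∑' m, Rn (m + (j + 1))‖ * ‖b (j + 1)‖ := ContinuousLinearMap.le_opNorm _ _
      _ ≤ (c * weightTail lam (j + 1)) * V :=
          mul_le_mul (h.norm_tsum_le hRn (by omega)) (hb j) (norm_nonneg _) (by positivity)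
      _ = _ := by ring

/-- Decay of correlations for observables of mean zero. -/
theorem exists_norm_integral_le (hS : S.IsExcellent E) {K : ℝ} (hK : 0 ≤ K)
    (hE : ∀ b, ∀ᵐ y ∂S.μ, ‖E.toL1 b y‖ ≤ K * ‖b‖) {lam : ℕ → ℝ} (h : IsDoublingWeight lam)
    {Ct : ℝ} (hCt : ∀ n, 1 ≤ n → S.μ.real {y | n < S.φ y} ≤ Ct * (lam n / n)) :
    ∃ C, 0 ≤ C ∧ ∀ (v : X → ℝ) (V : ℝ), 0 ≤ V → Integrable v S.μX → S.HasDerivedBound E v V →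
      ∫ x, v x ∂S.μX = 0 → ∀ (ω : X → ℂ) (W : ℝ), Measurable ω → 0 ≤ W → (∀ x, ‖ω x‖ ≤ W) →
      ∀ n, 1 ≤ n → ‖∫ x, (v x : ℂ) * ω (S.T^[n] x) ∂S.μX‖ ≤ C * V * W * weightTail lam n := by
  obtain ⟨Rn, hR, ⟨CR, hCR, hRn⟩, N, hN, KN, hNn⟩ := IsExcellent.exists_inverse S hS hK hE h hCt
  have hCt0 : 0 ≤ Ct := nonneg_of_mul_nonneg_left (measureReal_nonneg.trans (hCt 1 le_rfl))
    (div_pos (h.pos 1) (by norm_num))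
  -- The `+ 1` in `κ` covers index 0, where only `μ(φ > 0) ≤ 1` is available.
  obtain ⟨C₂, hC₂, hbound⟩ := h.exists_renewal_bound E.mass_unit hR.zero hN hNn
    (κ := K * (Ct + 1)) (by positivity)
  -- The product comes from the renewal sum, with `CR + K * Ct` bounding both the return densities
  -- and the masses of their partial sums; the last `K * Ct` comes from orbits not yet returned.
  refine ⟨C₂ * (CR + K * Ct) + K * Ct, by positivity, ?_⟩
  intro v V hV hv hvD hv0 ω W hω hW0 hW n hn
  have hs := h.summable_norm hRn
  have hcol := hvD.column_bound hK hE
  obtain ⟨b, hb, hbV⟩ := hvD.exists_before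
  have hβn : ∀ j, ‖returnDensity Rn b j‖ ≤ (CR + K * Ct) * V * weightTail lam j := fun j =>
    norm_returnDensity_le h (by positivity) hV (fun n hn => (hRn n hn).trans
      (mul_le_mul_of_nonneg_right (le_add_of_nonneg_right (by positivity)) (h.div_nonneg' n))) hbV j
  have hmass : ∀ m, ‖E.mass (∑ i ∈ Finset.range (m + 1), returnDensity Rn b i)‖ ≤
      (CR + K * Ct) * V * weightTail lam m := by
    intro m
    have h0 := h.weightTail_nonneg m
    rw [Finset.sum_range_succ', returnDensity_zero, add_zero]
    rcases Nat.eq_zero_or_pos m with rfl | hm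
    · rw [Finset.range_zero, Finset.sum_empty, map_zero, norm_zero]; positivity
    · simp only [returnDensity_succ]
      refine (hR.norm_mass_sum_le hs hv hv0 hcol hb m).trans ?_
      have h4 := mul_le_mul_of_nonneg_left (S.tailMean_le h hCt hm) (mul_nonneg hK hV)
      have h5 : 0 ≤ CR * V * weightTail lam m := by positivity
      linarith
  have hA : ∀ m, 1 ≤ m → ‖S.excursionPairing E hω hW0 hW m‖ ≤
      W * (K * (Ct + 1) * (lam m / m)) := fun m hm => by
    have h2 := mul_le_mul_of_nonneg_left (hCt m hm) (mul_nonneg hK hW0)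
    have h3 : 0 ≤ K * W * (lam m / m) := mul_nonneg (mul_nonneg hK hW0) (h.div_nonneg' m)
    refine (S.norm_excursionPairing_le hK hE hω hW0 hW m).trans ?_
    linarith
  have hA0 : ‖S.excursionPairing E hω hW0 hW 0‖ ≤ W * (K * (Ct + 1)) := by
    have h2 := mul_le_mul_of_nonneg_left
      (measureReal_le_one (μ := S.μ) (s := {y | 0 < S.φ y})) (mul_nonneg hK hW0)
    have h3 : 0 ≤ K * W * Ct := by positivity
    refine (S.norm_excursionPairing_le hK hE hω hW0 hW 0).trans ?_
    linarith
  have hmain := hbound (S.iteratePairing E hω hW) (S.excursionPairing E hω hW0 hW)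
    (returnDensity Rn b) ((CR + K * Ct) * V) W hW0 (hR.iteratePairing_eq hω hW0 hW) hA hA0 hβn
    hmass n
  have hsplit := hR.norm_sub_le hs hv hcol hb hω hW n
  have hsumeq : ∑ q ∈ Finset.HasAntidiagonal.antidiagonal n,
      S.iteratePairing E hω hW q.1 (returnDensity Rn b q.2) =
      ∑ j ∈ Finset.range n, S.iteratePairing E hω hW (n - (j + 1))
        ((∑' m, Rn (m + (j + 1))) (b (j + 1))) := by
    rw [← Finset.Nat.sum_antidiagonal_swap, Finset.Nat.sum_antidiagonal_eq_sum_range_succ_mk,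
      Finset.sum_range_succ']
    simp only [Prod.fst_swap, Prod.snd_swap, returnDensity_zero, map_zero, add_zero,
      returnDensity_succ]
  rw [hsumeq] at hmain
  have htri := (norm_le_norm_add_norm_sub' _ _).trans (add_le_add hmain hsplit)
  -- The mean return time multiplies the quantity to be bounded, and being at least 1 it can be
  -- dropped.
  have hm1 := S.one_le_meanTime
  rw [norm_mul, Complex.norm_real, Real.norm_of_nonneg (zero_le_one.trans hm1)] at htri
  have h1 := mul_le_mul_of_nonneg_right hm1
    (norm_nonneg (∫ x, (v x : ℂ) * ω (S.T^[n] x) ∂S.μX))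
  have h2 := mul_le_mul_of_nonneg_left (S.tailMean_le h hCt hn)
    (mul_nonneg (mul_nonneg hK hV) hW0)
  linarith

end InducingScheme

/-! ### Centring the observable and conclusion -/

namespace InducingScheme

variable {X : Type*} [MeasurableSpace X] (S : InducingScheme X)
  {B : Type*} [NormedAddCommGroup B] [NormedSpace ℂ B] [CompleteSpace B]
  {E : BanachFunctionSpace S.μ B}

theorem exchNorm_nonneg (v : X → ℝ) : 0 ≤ S.exchNorm E v :=
  Real.sSup_nonneg fun _ ⟨_, _, b, _, hr⟩ => hr ▸ norm_nonneg b

variable {S} in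
theorem IsExchangeable.hasDerivedBound {v : X → ℝ} (hv : S.IsExchangeable E v) :
    S.HasDerivedBound E v (S.exchNorm E v) := fun u hu => by
  obtain ⟨b, hb⟩ := hv.2.1 u hu
  exact ⟨b, hb, le_csSup hv.2.2 ⟨u, hu, b, hb, rfl⟩⟩

variable {S} in
-- Adding `c` carries an observable derived from `v - c` to one derived from `v`, and constants lie
-- in `B`.
theorem HasDerivedBound.sub_const {v : X → ℝ} {V : ℝ} (hv : S.HasDerivedBound E v V) (c : ℝ) :
    S.HasDerivedBound E (fun x => v x - c) (V + |c| * ‖E.unit‖) := by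
  intro u hu
  have hu' : (fun y => u y + c) ∈ S.derived v := fun n hn => by
    obtain ⟨j, hj, hju⟩ := hu n hn
    exact ⟨j, hj, fun y hy => by simp [hju y hy]⟩
  obtain ⟨b, hb, hbV⟩ := hv _ hu'
  refine ⟨b - (c : ℂ) • E.unit, ?_, (norm_sub_le _ _).trans ?_⟩
  · rw [map_sub, map_smul]
    filter_upwards [Lp.coeFn_sub (E.toL1 b) ((c : ℂ) • E.toL1 E.unit),
      Lp.coeFn_smul (c : ℂ) (E.toL1 E.unit), hb, E.toL1_unit] with y h1 h2 h3 h4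
    rw [h1, Pi.sub_apply, h2, Pi.smul_apply, h3, h4, smul_eq_mul, mul_one]
    push_cast
    ring
  · rw [norm_smul, Complex.norm_real, Real.norm_eq_abs]
    gcongr

/-- An essentially bounded observable has a measurable version bounded by its essential
supremum. -/
theorem _root_.MeasureTheory.MemLp.exists_measurable_bounded {α : Type*} [MeasurableSpace α]
    {μ : Measure α} {w : α → ℝ} (hw : MemLp w ∞ μ) :
    ∃ w' : α → ℝ, Measurable w' ∧ w =ᵐ[μ] w' ∧ ∀ x, ‖w' x‖ ≤ (eLpNorm w ∞ μ).toReal := by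
  set W := (eLpNorm w ∞ μ).toReal with hW
  set g := hw.1.mk w with hg
  have hgm : Measurable g := hw.1.stronglyMeasurable_mk.measurable
  have hset : MeasurableSet {x | ‖g x‖ ≤ W} := measurableSet_le hgm.norm measurable_const
  refine ⟨{x | ‖g x‖ ≤ W}.indicator g, hgm.indicator hset, ?_, fun x => ?_⟩
  · have h1 : ∀ᵐ x ∂μ, ‖w x‖ ≤ W := by
      have h2 := ae_le_eLpNormEssSup (f := w) (μ := μ)
      rw [← eLpNorm_exponent_top] at h2
      filter_upwards [h2] with x hx
      have := ENNReal.toReal_mono hw.2.ne hx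
      rwa [toReal_enorm] at this
    filter_upwards [h1, hw.1.ae_eq_mk] with x hx1 hx2
    rw [Set.indicator_of_mem]
    · exact hx2
    · change ‖g x‖ ≤ W
      rw [hg, ← hx2]; exact hx1
  · by_cases hx : x ∈ {x | ‖g x‖ ≤ W}
    · rw [Set.indicator_of_mem hx]; exact hx
    · rw [Set.indicator_of_notMem hx, norm_zero]; exact ENNReal.toReal_nonneg

/-- Correlations as integrals of a centred observable. -/
theorem corr_eq_integral {v w w' : X → ℝ} (hv : Integrable v S.μX) (hw' : Measurable w')
    {W : ℝ} (hW : ∀ x, ‖w' x‖ ≤ W) (hww' : w =ᵐ[S.μX] w') (n : ℕ) :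
    (S.corr v w n : ℂ) =
      ∫ x, ((v x - ∫ z, v z ∂S.μX : ℝ) : ℂ) * (w' (S.T^[n] x) : ℂ) ∂S.μX := by
  have hT := S.measurePreserving_T.iterate n
  have hwi : Integrable w' S.μX :=
    Integrable.of_bound hw'.aestronglyMeasurable W (ae_of_all _ hW)
  have h1 : ∫ x, v x * w (S.T^[n] x) ∂S.μX = ∫ x, v x * w' (S.T^[n] x) ∂S.μX := by
    refine integral_congr_ae ?_
    filter_upwards [hT.quasiMeasurePreserving.ae_eq_comp hww'] with x hx
    simp only [Function.comp_apply] at hx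
    rw [hx]
  have h2 : ∫ x, w' (S.T^[n] x) ∂S.μX = ∫ x, w' x ∂S.μX := by
    conv_rhs => rw [← hT.map_eq]
    exact (integral_map hT.measurable.aemeasurable hw'.aestronglyMeasurable).symm
  have h3 : Integrable (fun x => v x * w' (S.T^[n] x)) S.μX :=
    hv.mul_bdd (c := W) (hw'.comp hT.measurable).aestronglyMeasurable (ae_of_all _ fun x => hW _)
  have h4 : Integrable (fun x => (∫ z, v z ∂S.μX) * w' (S.T^[n] x)) S.μX :=
    (hT.integrable_comp_of_integrable hwi).const_mul _
  have h5 : S.corr v w n = ∫ x, (v x - ∫ z, v z ∂S.μX) * w' (S.T^[n] x) ∂S.μX := by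
    simp only [sub_mul]
    rw [integral_sub h3 h4, integral_const_mul, h2, corr, h1, integral_congr_ae hww']
  rw [h5, ← integral_complex_ofReal]
  simp

end InducingScheme

theorem mainTheorem10 {X : Type*} [MeasurableSpace X] (S : InducingScheme X)
    {B : Type*} [NormedAddCommGroup B] [NormedSpace ℂ B] [CompleteSpace B]
    (E : BanachFunctionSpace S.μ B) (hS : S.IsExcellent E) (hE : E.EmbeddedInLinfty)
    (ℓ : ℝ → ℝ) (hsv : IsSlowlyVarying ℓ)
    (hanti : ∀ m n : ℕ, 1 ≤ m → m ≤ n → ℓ n ≤ ℓ m)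
    (hlim : Tendsto (fun n : ℕ => ℓ n) atTop (𝓝 0))
    (htail : ∃ C : ℝ, ∀ n : ℕ, 1 ≤ n → S.μ.real {y | n < S.φ y} ≤ C * (ℓ n / n)) :
    ∃ C : ℝ, 0 < C ∧ ∀ v w : X → ℝ, S.IsExchangeable E v → MemLp w ∞ S.μX →
      ∀ n : ℕ, 1 ≤ n →
        ENNReal.ofReal |S.corr v w n| ≤
          ENNReal.ofReal (C * S.exchNorm E v * (eLpNorm w ∞ S.μX).toReal) *
            ∑' j : Set.Ici n, ENNReal.ofReal (ℓ (j : ℕ) / (j : ℕ)) := by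
  obtain ⟨K₀, hK₀⟩ := hE
  obtain ⟨K, hK, hEK⟩ : ∃ K : ℝ, 0 ≤ K ∧ ∀ b, ∀ᵐ y ∂S.μ, ‖E.toL1 b y‖ ≤ K * ‖b‖ := by
    refine ⟨|K₀|, abs_nonneg _, fun b => ?_⟩
    filter_upwards [hK₀ b] with y hy
    exact hy.trans (mul_le_mul_of_nonneg_right (le_abs_self _) (norm_nonneg _))
  obtain ⟨Ct, hCt⟩ := htail
  -- centred observables
  have hcent : ∀ v : X → ℝ, S.IsExchangeable E v → S.HasDerivedBound E
      (fun x => v x - ∫ z, v z ∂S.μX) ((1 + K * ‖E.unit‖) * S.exchNorm E v) := by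
    intro v hv
    have hD := hv.hasDerivedBound
    have hmean : |∫ z, v z ∂S.μX| ≤ K * S.exchNorm E v := by
      have h1 := S.norm_integral_mul_le (memLp_one_iff_integrable.1 hv.1)
        (hD.column_bound hK hEK) (ω := fun _ => 1) measurable_const (W := 1) (fun _ => by simp) 0
      simp only [mul_one] at h1
      rwa [integral_complex_ofReal, Complex.norm_real, Real.norm_eq_abs] at h1
    intro u hu
    obtain ⟨b, hb, hbV⟩ := hD.sub_const (∫ z, v z ∂S.μX) u hu
    refine ⟨b, hb, hbV.trans ?_⟩
    have := mul_le_mul_of_nonneg_right hmean (norm_nonneg E.unit)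
    linarith
  have hcentI : ∀ v : X → ℝ, S.IsExchangeable E v →
      Integrable (fun x => v x - ∫ z, v z ∂S.μX) S.μX := fun v hv =>
    (memLp_one_iff_integrable.1 hv.1).sub (integrable_const _)
  -- the case of a vanishing right hand side
  have hzero : ∀ v w : X → ℝ, S.IsExchangeable E v → MemLp w ∞ S.μX → ∀ n : ℕ,
      S.exchNorm E v * (eLpNorm w ∞ S.μX).toReal = 0 → S.corr v w n = 0 := by
    intro v w hv hw n h0
    obtain ⟨w', hw'm, hww', hw'b⟩ := hw.exists_measurable_bounded
    have h1 := S.corr_eq_integral (memLp_one_iff_integrable.1 hv.1) hw'm hw'b hww' n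
    have h2 := S.norm_integral_mul_le (hcentI v hv) ((hcent v hv).column_bound hK hEK)
      (ω := fun x => (w' x : ℂ)) (Complex.measurable_ofReal.comp hw'm)
      (W := (eLpNorm w ∞ S.μX).toReal) (fun x => by rw [Complex.norm_real]; exact hw'b x) n
    rw [← h1, Complex.norm_real, show K * ((1 + K * ‖E.unit‖) * S.exchNorm E v) *
      (eLpNorm w ∞ S.μX).toReal = K * (1 + K * ‖E.unit‖) *
        (S.exchNorm E v * (eLpNorm w ∞ S.μX).toReal) by ring, h0, mul_zero] at h2
    exact norm_le_zero_iff.1 h2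
  by_cases hsum : Summable fun n : ℕ => ℓ n / n
  · have h := hsv.isDoublingWeight hanti hlim hsum
    obtain ⟨C, hC, hmain⟩ := S.exists_norm_integral_le hS hK hEK h (Ct := Ct) fun n hn => by
      rw [seqWeight_of_pos ℓ hn]; exact hCt n hn
    -- The factor `1 + K * ‖E.unit‖` is the cost of centring; the `+ 1` makes the constant strictly
    -- positive.
    refine ⟨C * (1 + K * ‖E.unit‖) + 1, by positivity, fun v w hv hw n hn => ?_⟩
    obtain ⟨w', hw'm, hww', hw'b⟩ := hw.exists_measurable_bounded
    have hVn := S.exchNorm_nonneg (E := E) v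
    have h1 := S.corr_eq_integral (memLp_one_iff_integrable.1 hv.1) hw'm hw'b hww' n
    have h2 := hmain _ ((1 + K * ‖E.unit‖) * S.exchNorm E v) (by positivity) (hcentI v hv)
      (hcent v hv) (by
        rw [integral_sub (memLp_one_iff_integrable.1 hv.1) (integrable_const _)]
        simp) (fun x => (w' x : ℂ)) _ (Complex.measurable_ofReal.comp hw'm)
      ENNReal.toReal_nonneg (fun x => by rw [Complex.norm_real]; exact hw'b x) n hn
    rw [← h1, Complex.norm_real, Real.norm_eq_abs] at h2
    rw [tsum_Ici_eq_weightTail h hn, ← ENNReal.ofReal_mul (by positivity)]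
    refine ENNReal.ofReal_le_ofReal (h2.trans ?_)
    refine mul_le_mul_of_nonneg_right ?_ (h.weightTail_nonneg n)
    have : 0 ≤ S.exchNorm E v * (eLpNorm w ∞ S.μX).toReal := by positivity
    linarith
  -- In the divergent case every tail is infinite, so only a vanishing prefactor needs an argument.
  · refine ⟨1, one_pos, fun v w hv hw n hn => ?_⟩
    by_cases h0 : S.exchNorm E v * (eLpNorm w ∞ S.μX).toReal = 0
    · rw [hzero v w hv hw n h0]; simp
    · have htop : ∑' j : Set.Ici n, ENNReal.ofReal (ℓ (j : ℕ) / (j : ℕ)) = ∞ := by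
        by_contra hne
        exact hsum (summable_of_tsum_Ici_ne_top hsv hn hne)
      have hpos : 0 < 1 * S.exchNorm E v * (eLpNorm w ∞ S.μX).toReal := by
        rw [one_mul]
        exact lt_of_le_of_ne
          (mul_nonneg (S.exchNorm_nonneg v) ENNReal.toReal_nonneg) (Ne.symm h0)
      rw [htop, ENNReal.mul_top (ENNReal.ofReal_pos.2 hpos).ne']
      exact le_top
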